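/- Let $d\ge 1$ be an integer. A (half-open) rectangle in $[0,1)^n$ is a product $\prod_{j=1}^n[a_j,b_j)$ with $0\le a_j<b_j\le 1$ for all $j$ (a single point if $n=0$). Let $\operatorname{Rec}_d$ be the group, under composition, of all permutations $f$ of $[0,1)^d$ for which there is a finite partition of $[0,1)^d$ into rectangles such that $f$ is a translation on each rectangle of the partition. A restricted rotation is a permutation $s$ of $[0,1)$ such that, for some reals $0\le a<b<c\le 1$, $s(t)=t+(c-b)$ for $t\in[a,b)$, $s(t)=t-(b-a)$ for $t\in[b,c)$, and $s(t)=t$ for $t\notin[a,c)$. For $1\le i\le d$, a restricted rotation $s$ and a rectangle $R\subset[0,1)^{d-1}$ (with coordinates indexed by the $j\ne i$), the restricted shuffle $\sigma_{R,s,i}$ is the permutation of $[0,1)^d$ that fixes $x$ if $(x_j)_{j\neq i}\notin R$, and that replaces the coordinate $x_i$ of $x$ by $s(x_i)$ and leaves the other coordinates unchanged if $(x_j)_{j\ne i}\in R$. In other words, it exchanges, by translations in the $i$-th coordinate direction, two rectangles sharing a facet orthogonal to that direction, and is the identity elsewhere. Then the set of all restricted shuffles (for all $R$, $s$ and $i$)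 is a generating subset of the group $\operatorname{Rec}_d$: all restricted shuffles belong to $\operatorname{Rec}_d$, and the subgroup they generate is $\operatorname{Rec}_d$. -/

import Mathlib

namespace RectangleExchange

/-- The half-open unit cube `[0,1)^ι` as a set of points of `ℝ^ι`. -/
def unitCube (ι : Type*) : Set (ι → ℝ) := {x | ∀ i, x i ∈ Set.Ico (0 : ℝ) 1}

/-- A half-open subrectangle of `[0,1)^ι`: a product of nonempty half-open intervals
`[a i, b i) ⊆ [0,1)`. If `ι` is empty, this is the one-point space. -/
def IsRectangle {ι : Type*} (K : Set (ι → ℝ)) : Prop :=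
  ∃ a b : ι → ℝ, (∀ i, 0 ≤ a i ∧ a i < b i ∧ b i ≤ 1) ∧
    K = {x | ∀ i, x i ∈ Set.Ico (a i) (b i)}

/-- A finite partition of the unit cube into half-open rectangles. -/
structure IsRectanglePartition {ι : Type*} (P : Set (Set (ι → ℝ))) : Prop where
  finite : P.Finite
  isRectangle : ∀ K ∈ P, IsRectangle K
  pairwiseDisjoint : ∀ K ∈ P, ∀ L ∈ P, K ≠ L → Disjoint K L
  sUnion_eq : ⋃₀ P = unitCube ι

/-- The permutation `f` of the unit cube is a translation on each of the sets in `P`. -/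
def IsTranslationOn {ι : Type*} (f : Equiv.Perm (unitCube ι)) (P : Set (Set (ι → ℝ))) : Prop :=
  ∀ K ∈ P, ∃ v : ι → ℝ, ∀ x : unitCube ι, (x : ι → ℝ) ∈ K → (f x : ι → ℝ) = x + v

/-- A rectangle exchange transformation: a permutation of the unit cube that is a translation
on each of the pieces of some finite partition into rectangles. -/
def IsRectangleExchange {ι : Type*} (f : Equiv.Perm (unitCube ι)) : Prop :=
  ∃ P : Set (Set (ι → ℝ)), IsRectanglePartition P ∧ IsTranslationOn f P

theorem IsRectangle.of_box {ι : Type*} {K : Set (ι → ℝ)} (a b : ι → ℝ)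
    (hK : K = {x | ∀ i, x i ∈ Set.Ico (a i) (b i)}) (hne : K.Nonempty)
    (hsub : K ⊆ unitCube ι) : IsRectangle K := by
  classical
  subst hK
  obtain ⟨y, hy⟩ := hne
  have hab : ∀ i, a i < b i := fun i => (hy i).1.trans_lt (hy i).2
  refine ⟨a, b, fun i => ⟨?_, hab i, ?_⟩, rfl⟩
  · exact (hsub (show a ∈ _ from fun j => ⟨le_rfl, hab j⟩) i).1
  · by_contra! h
    have hz : Function.update y i (max (y i) 1) ∈
        {x : ι → ℝ | ∀ i, x i ∈ Set.Ico (a i) (b i)} := by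
      intro j
      by_cases hj : j = i
      · subst hj
        simp only [Function.update_self]
        exact ⟨(hy j).1.trans (le_max_left _ _), max_lt (hy j).2 h⟩
      · simpa [Function.update_of_ne hj] using hy j
    have h1 := (hsub hz i).2
    simp at h1

theorem IsRectanglePartition.subset {ι : Type*} {P : Set (Set (ι → ℝ))}
    (hP : IsRectanglePartition P) {K : Set (ι → ℝ)} (hK : K ∈ P) : K ⊆ unitCube ι :=
  (Set.subset_sUnion_of_mem hK).trans hP.sUnion_eq.subset

theorem IsRectanglePartition.exists_mem {ι : Type*} {P : Set (Set (ι → ℝ))}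
    (hP : IsRectanglePartition P) (x : unitCube ι) : ∃ K ∈ P, (x : ι → ℝ) ∈ K := by
  have h : (x : ι → ℝ) ∈ ⋃₀ P := by rw [hP.sUnion_eq]; exact x.2
  simpa using h

theorem IsRectanglePartition.eq_of_mem {ι : Type*} {P : Set (Set (ι → ℝ))}
    (hP : IsRectanglePartition P) {K L : Set (ι → ℝ)} (hK : K ∈ P) (hL : L ∈ P) {x : ι → ℝ}
    (hxK : x ∈ K) (hxL : x ∈ L) : K = L := by
  by_contra h
  exact Set.disjoint_left.1 (hP.pairwiseDisjoint K hK L hL h) hxK hxL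

theorem isRectangleExchange_one {ι : Type*} :
    IsRectangleExchange (1 : Equiv.Perm (unitCube ι)) := by
  refine ⟨{unitCube ι}, ⟨Set.finite_singleton _, ?_, ?_, by simp⟩, ?_⟩
  · rintro K rfl
    exact ⟨fun _ => 0, fun _ => 1, fun i => by norm_num, rfl⟩
  · rintro K rfl L rfl h
    exact absurd rfl h
  · intro K _
    exact ⟨0, fun x _ => by simp⟩

theorem IsRectangleExchange.mul {ι : Type*} {g f : Equiv.Perm (unitCube ι)}
    (hg : IsRectangleExchange g) (hf : IsRectangleExchange f) :
    IsRectangleExchange (g * f) := by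
  classical
  obtain ⟨Q, hQ, hgQ⟩ := hg
  obtain ⟨P, hP, hfP⟩ := hf
  choose! v hv using hfP
  choose! w hw using hgQ
  refine ⟨{M | M.Nonempty ∧ ∃ K ∈ P, ∃ L ∈ Q, K ∩ {x | x + v K ∈ L} = M},
    ⟨?_, ?_, ?_, ?_⟩, ?_⟩
  · exact (hP.finite.image2 (fun K L => K ∩ {x | x + v K ∈ L}) hQ.finite).subset
      fun M hM => by
        obtain ⟨_, K, hK, L, hL, h⟩ := hM
        exact ⟨K, hK, L, hL, h⟩
  · rintro M ⟨hne, K, hK, L, hL, rfl⟩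
    obtain ⟨a, b, -, hKe⟩ := hP.isRectangle K hK
    obtain ⟨a', b', -, hLe⟩ := hQ.isRectangle L hL
    refine IsRectangle.of_box (fun i => max (a i) (a' i - v K i))
      (fun i => min (b i) (b' i - v K i)) ?_ hne
      (Set.inter_subset_left.trans (hP.subset hK))
    generalize v K = u
    subst hKe hLe
    ext x
    simp only [Set.mem_inter_iff, Set.mem_ofPred_eq, Set.mem_Ico, Pi.add_apply, max_le_iff,
      lt_min_iff, ← forall_and]
    refine forall_congr' fun i => ?_
    rw [sub_le_iff_le_add, lt_sub_iff_add_lt]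
    tauto
  · rintro M ⟨-, K, hK, L, hL, rfl⟩ M' ⟨-, K', hK', L', hL', rfl⟩ hne
    rw [Set.disjoint_left]
    rintro x ⟨h1, h2⟩ ⟨h3, h4⟩
    obtain rfl := hP.eq_of_mem hK hK' h1 h3
    obtain rfl := hQ.eq_of_mem hL hL' h2 h4
    exact hne rfl
  · ext x
    constructor
    · rintro ⟨M, ⟨-, K, hK, L, hL, rfl⟩, hx⟩
      exact hP.subset hK hx.1
    · intro hx
      obtain ⟨K, hK, hxK⟩ := hP.exists_mem ⟨x, hx⟩
      obtain ⟨L, hL, hxL⟩ := hQ.exists_mem (f ⟨x, hx⟩)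
      rw [hv K hK _ hxK] at hxL
      exact Set.mem_sUnion.2 ⟨K ∩ {x | x + v K ∈ L},
        ⟨⟨x, hxK, hxL⟩, K, hK, L, hL, rfl⟩, hxK, hxL⟩
  · rintro M ⟨-, K, hK, L, hL, rfl⟩
    refine ⟨v K + w L, ?_⟩
    rintro x ⟨hxK, hxL⟩
    have h1 := hv K hK x hxK
    have h2 := hw L hL (f x) (by rw [h1]; exact hxL)
    rw [Equiv.Perm.mul_apply, h2, h1, add_assoc]

theorem IsRectangleExchange.inv {ι : Type*} {f : Equiv.Perm (unitCube ι)}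
    (hf : IsRectangleExchange f) : IsRectangleExchange f⁻¹ := by
  classical
  obtain ⟨P, hP, hfP⟩ := hf
  choose! v hv using hfP
  have key : ∀ K ∈ P, ∀ x : ι → ℝ, x - v K ∈ K →
      ∃ h : x ∈ unitCube ι, ((f⁻¹ ⟨x, h⟩ : unitCube ι) : ι → ℝ) = x - v K := by
    intro K hK x hx
    have h1 := hv K hK ⟨_, hP.subset hK hx⟩ hx
    simp only [sub_add_cancel] at h1
    have h : x ∈ unitCube ι := h1 ▸ (f ⟨_, hP.subset hK hx⟩).2
    refine ⟨h, ?_⟩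
    have h2 : (⟨x, h⟩ : unitCube ι) = f ⟨_, hP.subset hK hx⟩ := Subtype.ext h1.symm
    rw [h2]
    exact congrArg Subtype.val (f.symm_apply_apply _)
  refine ⟨(fun K => {x | x - v K ∈ K}) '' P, ⟨hP.finite.image _, ?_, ?_, ?_⟩, ?_⟩
  · rintro M ⟨K, hK, rfl⟩
    have hs : {x | x - v K ∈ K} ⊆ unitCube ι := fun x hx => (key K hK x hx).1
    obtain ⟨a, b, hab, hKe⟩ := hP.isRectangle K hK
    refine IsRectangle.of_box (fun i => a i + v K i) (fun i => b i + v K i) ?_ ⟨a + v K, ?_⟩ hs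
    · simp only
      generalize v K = u
      subst hKe
      ext x
      refine forall_congr' fun i => ?_
      simp only [Set.mem_Ico, Pi.sub_apply]
      rw [le_sub_iff_add_le, sub_lt_iff_lt_add]
    · simp only [Set.mem_ofPred_eq, add_sub_cancel_right]
      rw [hKe]
      exact fun i => ⟨le_rfl, (hab i).2.1⟩
  · rintro M ⟨K, hK, rfl⟩ M' ⟨K', hK', rfl⟩ hne
    rw [Set.disjoint_left]
    intro x h1 h2
    obtain ⟨h, e1⟩ := key K hK x h1
    obtain ⟨_, e2⟩ := key K' hK' x h2
    obtain rfl := hP.eq_of_mem hK hK' h1 (by rw [← e1, e2]; exact h2)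
    exact hne rfl
  · ext x
    constructor
    · rintro ⟨M, ⟨K, hK, rfl⟩, hx⟩
      exact (key K hK x hx).1
    · intro hx
      obtain ⟨K, hK, hxK⟩ := hP.exists_mem (f⁻¹ ⟨x, hx⟩)
      have h := hv K hK _ hxK
      rw [show f (f⁻¹ ⟨x, hx⟩) = ⟨x, hx⟩ from f.apply_symm_apply _] at h
      refine ⟨_, ⟨K, hK, rfl⟩, ?_⟩
      have h' : x - v K = ((f⁻¹ ⟨x, hx⟩ : unitCube ι) : ι → ℝ) := by
        rw [sub_eq_iff_eq_add]; exact h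
      simp only [Set.mem_ofPred_eq, h']
      exact hxK
  · rintro M ⟨K, hK, rfl⟩
    refine ⟨-v K, fun x hx => ?_⟩
    obtain ⟨_, e⟩ := key K hK x hx
    rw [← sub_eq_add_neg]
    exact e

/-- The group `Rec_d` of rectangle exchange transformations of `[0,1)^d`, as a subgroup of the
group of all permutations of `[0,1)^d`. -/
def Rec (d : ℕ) : Subgroup (Equiv.Perm (unitCube (Fin d))) where
  carrier := {f | IsRectangleExchange f}
  mul_mem' := IsRectangleExchange.mul
  one_mem' := isRectangleExchange_one
  inv_mem' := IsRectangleExchange.inv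

/-- A restricted rotation: for some `0 ≤ a < b < c ≤ 1` it exchanges, by translations, the two
consecutive intervals `[a,b)` and `[b,c)`, and it is the identity outside `[a,c)`. -/
def IsRestrictedRotation (s : Equiv.Perm (Set.Ico (0 : ℝ) 1)) : Prop :=
  ∃ a b c : ℝ, 0 ≤ a ∧ a < b ∧ b < c ∧ c ≤ 1 ∧
    ∀ t : Set.Ico (0 : ℝ) 1,
      ((t : ℝ) ∈ Set.Ico a b → (s t : ℝ) = t + (c - b)) ∧
      ((t : ℝ) ∈ Set.Ico b c → (s t : ℝ) = t - (b - a)) ∧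
      ((t : ℝ) ∉ Set.Ico a c → s t = t)

/-- The projection forgetting the `i`-th coordinate; the hyperplane orthogonal to the `i`-th
basis vector is identified with the space of families of reals indexed by `{j // j ≠ i}`. -/
def prPerp {ι : Type*} (i : ι) (x : ι → ℝ) : {j : ι // j ≠ i} → ℝ := fun j => x j

open Classical in
/-- The self-map of the unit cube which applies `s` to the `i`-th coordinate of the points whose
projection forgetting the `i`-th coordinate is in `R`, and fixes all other points. -/
noncomputable def shuffleMap {ι : Type*} [DecidableEq ι] (i : ι) (R : Set ({j : ι // j ≠ i} → ℝ))
    (s : Equiv.Perm (Set.Ico (0 : ℝ) 1)) (x : unitCube ι) : unitCube ι :=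
  if prPerp i (x : ι → ℝ) ∈ R then
    ⟨Function.update (x : ι → ℝ) i (s ⟨(x : ι → ℝ) i, x.2 i⟩), fun j => by
      by_cases hj : j = i
      · subst hj
        rw [Function.update_self]
        exact (s _).2
      · rw [Function.update_of_ne hj]
        exact x.2 j⟩
  else x

theorem shuffleMap_leftInverse {ι : Type*} [DecidableEq ι] (i : ι) (R : Set ({j : ι // j ≠ i} → ℝ))
    {s s' : Equiv.Perm (Set.Ico (0 : ℝ) 1)} (h : Function.LeftInverse s' s) :
    Function.LeftInverse (shuffleMap i R s') (shuffleMap i R s) := by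
  intro x
  by_cases hx : prPerp i (x : ι → ℝ) ∈ R
  · have h1 : prPerp i (Function.update (x : ι → ℝ) i (s ⟨(x : ι → ℝ) i, x.2 i⟩ : ℝ)) =
        prPerp i (x : ι → ℝ) := by
      funext j
      exact Function.update_of_ne j.2 _ _
    apply Subtype.ext
    simp [shuffleMap, hx, h1, h (⟨(x : ι → ℝ) i, x.2 i⟩ : Set.Ico (0 : ℝ) 1)]
  · simp [shuffleMap, hx]

/-- The permutation `σ_{R,s,i}` of the unit cube. -/
noncomputable def shuffle {ι : Type*} [DecidableEq ι] (i : ι) (R : Set ({j : ι // j ≠ i} → ℝ))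
    (s : Equiv.Perm (Set.Ico (0 : ℝ) 1)) : Equiv.Perm (unitCube ι) where
  toFun := shuffleMap i R s
  invFun := shuffleMap i R s.symm
  left_inv := shuffleMap_leftInverse i R s.left_inv
  right_inv := shuffleMap_leftInverse i R s.right_inv

/-- The set of all restricted shuffles of `[0,1)^d`: the maps `σ_{R,s,i}` where `i` is one of the
`d` directions, `R` is a half-open rectangle in the hyperplane orthogonal to the direction `i`,
and `s` is a restricted rotation. -/
def restrictedShuffles (d : ℕ) : Set (Equiv.Perm (unitCube (Fin d))) :=
  {f | ∃ (i : Fin d) (R : Set ({j : Fin d // j ≠ i} → ℝ)) (s : Equiv.Perm (Set.Ico (0 : ℝ) 1)),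
    IsRectangle R ∧ IsRestrictedRotation s ∧ f = shuffle i R s}

end RectangleExchange

/-!
# Restricted shuffles generate the group of rectangle exchanges

A rectangle exchange that changes a single coordinate is, over each of finitely many rectangles of
the orthogonal hyperplane, an interval exchange, and interval exchanges are products of restricted
rotations: a rotation brings an interval to its place and removes one breakpoint
(`IsPiecewiseTranslation.mem_closure`, `mem_closure_restrictedShuffles_of_axis`). So it suffices
to write every rectangle exchange as a product of rectangle exchanges along the axes.

This is proved by induction on the dimension, for exchanges of finitely many layers, that is of
copies of the cube, where besides exchanges along the axes also swaps of two layers over a part of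
the cube are allowed as factors (`IsExchange.mem_axisLayerSubgroup`). Let `f` be an exchange in
dimension `n + 1`, a translation on each cell of a grid. The coordinates of the grid cut `[0,1)`
into intervals whose lengths are finitely many positive reals. These are sums of elements of a
finite set of positive reals that are linearly independent over `ℚ`
(`exists_linearIndepOn_closure`), so that `[0,1)` can be subdivided further into slots with
independent lengths (`exists_isSubdivision_linearIndepOn`). Over each point of the remaining `n`
coordinates and each layer, `f` maps slots of the first coordinate onto consecutive intervals that
partition `[0,1)`. Since the lengths are independent, the coordinate functionals show that this
partition uses each length as often as the subdivision into slots
(`IsSubdivision.exists_equiv`). Hence an exchange along the first axis sorts these intervals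
into the slots, each going to a slot of its own length (`IsSubdivision.exists_sorting`,
`exists_fiberPerm_mul_eq_lift`). Composed with it, `f` maps slots to slots of the same length by
translations, which amounts to an exchange in dimension `n` in which the slots serve as additional
layers. The induction hypothesis applies, and a swap of two slots of the same length is a product of
exchanges along the first axis and of swaps of layers
(`IsSubdivision.lift_mem_of_mem_layerExchanges`). In the end there is only one layer, and swaps
of layers are trivial.
-/

namespace RectangleExchange

/-! ### Independent lengths -/

theorem mem_span_nnrat_trans {T T' : Finset ℝ} {x : ℝ}
    (hx : x ∈ Submodule.span ℚ≥0 (T : Set ℝ))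
    (h : ∀ t ∈ T, t ∈ Submodule.span ℚ≥0 (T' : Set ℝ)) :
    x ∈ Submodule.span ℚ≥0 (T' : Set ℝ) :=
  Submodule.span_le.2 (fun t ht => h t ht) hx

/-- Two disjoint sets `I, J ⊆ T` of positive reals with the same sum make one generator of the
cone spanned by `T` superfluous. As in the Euclidean algorithm, the larger one of some `i ∈ I` and
`j ∈ J` is replaced by their difference, which shortens the relation `∑ I = ∑ J` by one term. -/
theorem exists_card_lt_of_sum_eq_sum (n : ℕ) : ∀ (T I J : Finset ℝ), I.card + J.card = n →
    (∀ t ∈ T, 0 < t) → I ⊆ T → J ⊆ T → Disjoint I J → I.Nonempty → J.Nonempty →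
    ∑ t ∈ I, t = ∑ t ∈ J, t →
    ∃ T' : Finset ℝ, (∀ t ∈ T', 0 < t) ∧ T'.card < T.card ∧
      ∀ t ∈ T, t ∈ Submodule.span ℚ≥0 (T' : Set ℝ) := by
  induction n with
  | zero =>
    intro T I J hc _ _ _ _ hI
    have := hI.card_pos
    omega
  | succ n ih =>
    have key : ∀ (T I J : Finset ℝ), I.card + J.card = n + 1 →
        (∀ t ∈ T, 0 < t) → I ⊆ T → J ⊆ T → Disjoint I J →
        ∑ t ∈ I, t = ∑ t ∈ J, t → ∀ i ∈ I, ∀ j ∈ J, j < i →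
        ∃ T' : Finset ℝ, (∀ t ∈ T', 0 < t) ∧ T'.card < T.card ∧
          ∀ t ∈ T, t ∈ Submodule.span ℚ≥0 (T' : Set ℝ) := by
      intro T I J hc hT hIT hJT hd hs i hi j hj hji
      have hiJ : i ∉ J := Finset.disjoint_left.1 hd hi
      -- Whatever contains `i - j` and the rest of `T` also generates `i`.
      have hspan : ∀ S : Finset ℝ, i - j ∈ S → T.erase i ⊆ S →
          ∀ t ∈ T, t ∈ Submodule.span ℚ≥0 (S : Set ℝ) := by
        intro S h1 h2 t ht
        by_cases hti : t = i
        · subst hti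
          have h3 : j ∈ S := h2 (Finset.mem_erase.2 ⟨hji.ne, hJT hj⟩)
          have := add_mem (Submodule.subset_span (R := ℚ≥0) (Finset.mem_coe.2 h1))
            (Submodule.subset_span (R := ℚ≥0) (Finset.mem_coe.2 h3))
          simpa using this
        · exact Submodule.subset_span (h2 (Finset.mem_erase.2 ⟨hti, ht⟩))
      have hcard := Finset.card_erase_of_mem (hIT hi)
      have hTpos : 0 < T.card := Finset.card_pos.2 ⟨i, hIT hi⟩
      by_cases hmem : i - j ∈ T
      · refine ⟨T.erase i, fun t ht => hT t (Finset.mem_of_mem_erase ht), by omega,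
          hspan _ (Finset.mem_erase.2 ⟨?_, hmem⟩) subset_rfl⟩
        have := hT j (hJT hj)
        intro h
        linarith
      · have hIe : i - j ∉ I.erase i := fun h => hmem (hIT (Finset.mem_of_mem_erase h))
        have hTe : i - j ∉ T.erase i := fun h => hmem (Finset.mem_of_mem_erase h)
        have hsum : ∑ t ∈ insert (i - j) (I.erase i), t = ∑ t ∈ J.erase j, t := by
          rw [Finset.sum_insert hIe]
          have h1 := Finset.add_sum_erase I (fun t => t) hi
          have h2 := Finset.add_sum_erase J (fun t => t) hj
          linarith
        have hTpos' : ∀ t ∈ insert (i - j) (T.erase i), 0 < t := by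
          intro t ht
          rcases Finset.mem_insert.1 ht with rfl | ht
          · linarith
          · exact hT t (Finset.mem_of_mem_erase ht)
        have hI2 : insert (i - j) (I.erase i) ⊆ insert (i - j) (T.erase i) :=
          Finset.insert_subset_insert _ (Finset.erase_subset_erase _ hIT)
        have hJne : (J.erase j).Nonempty := by
          by_contra h
          rw [Finset.not_nonempty_iff_eq_empty] at h
          rw [h, Finset.sum_empty] at hsum
          have := Finset.sum_pos (fun t ht => hTpos' t (hI2 ht)) ⟨_, Finset.mem_insert_self _ _⟩
          linarith
        obtain ⟨T', h1, h2, h3⟩ := ih (insert (i - j) (T.erase i)) (insert (i - j) (I.erase i))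
          (J.erase j) (by
            rw [Finset.card_insert_of_notMem hIe, Finset.card_erase_of_mem hi,
              Finset.card_erase_of_mem hj]
            have := Finset.card_pos.2 ⟨i, hi⟩
            have := Finset.card_pos.2 ⟨j, hj⟩
            omega) hTpos' hI2
          (fun t ht => Finset.mem_insert_of_mem (Finset.mem_erase.2
            ⟨fun h => hiJ (h ▸ Finset.mem_of_mem_erase ht), hJT (Finset.mem_of_mem_erase ht)⟩))
          (by
            rw [Finset.disjoint_insert_left]
            exact ⟨fun h => hmem (hJT (Finset.mem_of_mem_erase h)),
              hd.mono (Finset.erase_subset _ _) (Finset.erase_subset _ _)⟩)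
          ⟨_, Finset.mem_insert_self _ _⟩ hJne hsum
        refine ⟨T', h1, ?_, fun t ht => mem_span_nnrat_trans
          (hspan _ (Finset.mem_insert_self _ _) (Finset.subset_insert _ _) t ht) h3⟩
        rw [Finset.card_insert_of_notMem hTe] at h2
        omega
    intro T I J hc hT hIT hJT hd hI hJ hs
    obtain ⟨i, hi⟩ := hI
    obtain ⟨j, hj⟩ := hJ
    rcases lt_trichotomy i j with h | h | h
    · exact key T J I (by omega) hT hJT hIT hd.symm hs.symm j hj i hi h
    · subst h
      exact absurd hj (Finset.disjoint_left.1 hd hi)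
    · exact key T I J hc hT hIT hJT hd hs i hi j hj h

/-- Generators of a cone in `ℝ` that are linearly dependent over `ℚ` can be replaced by fewer ones. -/
theorem exists_card_lt_of_not_linearIndepOn {T : Finset ℝ} (hT : ∀ t ∈ T, 0 < t)
    (hdep : ¬ LinearIndepOn ℚ id (T : Set ℝ)) :
    ∃ T' : Finset ℝ, (∀ t ∈ T', 0 < t) ∧ T'.card < T.card ∧
      ∀ t ∈ T, t ∈ Submodule.span ℚ≥0 (T' : Set ℝ) := by
  classical
  rw [linearIndepOn_finset_iff] at hdep
  push Not at hdep
  obtain ⟨f, hf, t₀, ht₀, hft₀⟩ := hdep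
  -- Rescaling the elements of `T` turns the coefficients of the relation into `±1`.
  set q : ℝ → ℚ≥0 := fun t => if f t = 0 then 1 else Rat.nnabs (f t) with hq
  have hq0 : ∀ t, 0 < q t := by
    intro t
    by_cases h : f t = 0
    · simp [hq, h]
    · simp only [hq, h, if_false]
      exact pos_iff_ne_zero.2 (by simpa [← NNRat.coe_ne_zero] using h)
  set w : ℝ → ℝ := fun t => q t • t with hw
  have hwpos : ∀ t ∈ T.image w, 0 < t := by
    intro t ht
    obtain ⟨s, hs, rfl⟩ := Finset.mem_image.1 ht
    simp only [hw, NNRat.smul_def]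
    exact mul_pos (by exact_mod_cast hq0 s) (hT s hs)
  have hspan : ∀ t ∈ T, t ∈ Submodule.span ℚ≥0 ((T.image w : Finset ℝ) : Set ℝ) := by
    intro t ht
    have := Submodule.smul_mem _ (q t)⁻¹ (Submodule.subset_span (R := ℚ≥0)
      (Finset.mem_coe.2 (Finset.mem_image_of_mem w ht)))
    simpa only [hw, inv_smul_smul₀ (hq0 t).ne'] using this
  rcases Finset.card_image_le.lt_or_eq (a := (T.image w).card) (b := T.card) with hlt | heq
  · exact ⟨_, hwpos, hlt, hspan⟩
  have hinj : Set.InjOn w (T : Set ℝ) := Finset.card_image_iff.1 heq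
  set P := T.filter (fun t => 0 < f t) with hP
  set N := T.filter (fun t => f t < 0) with hN
  have hwP : ∑ t ∈ P.image w, t = ∑ t ∈ P, (f t : ℝ) * t := by
    rw [Finset.sum_image (hinj.mono (Finset.coe_subset.2 (Finset.filter_subset _ _)))]
    refine Finset.sum_congr rfl fun t ht => ?_
    have h : 0 < f t := (Finset.mem_filter.1 ht).2
    have : ((q t : ℚ≥0) : ℝ) = f t := by
      have : ((q t : ℚ≥0) : ℚ) = f t := by simp [hq, h.ne', abs_of_pos h]
      exact_mod_cast congrArg (Rat.cast (K := ℝ)) this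
    simp [hw, NNRat.smul_def, this]
  have hwN : ∑ t ∈ N.image w, t = - ∑ t ∈ N, (f t : ℝ) * t := by
    rw [Finset.sum_image (hinj.mono (Finset.coe_subset.2 (Finset.filter_subset _ _))),
      ← Finset.sum_neg_distrib]
    refine Finset.sum_congr rfl fun t ht => ?_
    have h : f t < 0 := (Finset.mem_filter.1 ht).2
    have : ((q t : ℚ≥0) : ℝ) = -f t := by
      have : ((q t : ℚ≥0) : ℚ) = -f t := by simp [hq, h.ne, abs_of_neg h]
      exact_mod_cast congrArg (Rat.cast (K := ℝ)) this
    simp [hw, NNRat.smul_def, this]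
  have hPN : ∑ t ∈ P, (f t : ℝ) * t + ∑ t ∈ N, (f t : ℝ) * t = 0 := by
    rw [hP, hN, Finset.sum_filter, Finset.sum_filter, ← Finset.sum_add_distrib]
    refine Eq.trans ?_ hf
    refine Finset.sum_congr rfl fun t _ => ?_
    rcases lt_trichotomy (f t) 0 with h | h | h
    · simp [h, h.not_gt, Rat.smul_def]
    · simp [h]
    · simp [h, h.not_gt, Rat.smul_def]
  have hPT : P.image w ⊆ T.image w := Finset.image_subset_image (Finset.filter_subset _ _)
  have hNT : N.image w ⊆ T.image w := Finset.image_subset_image (Finset.filter_subset _ _)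
  have hsum : ∑ t ∈ P.image w, t = ∑ t ∈ N.image w, t := by linarith
  have hiff : (P.image w).Nonempty ↔ (N.image w).Nonempty := by
    constructor
    · intro h
      have := Finset.sum_pos (fun t ht => hwpos t (hPT ht)) h
      by_contra h'
      rw [Finset.not_nonempty_iff_eq_empty] at h'
      rw [hsum, h', Finset.sum_empty] at this
      exact this.false
    · intro h
      have := Finset.sum_pos (fun t ht => hwpos t (hNT ht)) h
      by_contra h'
      rw [Finset.not_nonempty_iff_eq_empty] at h'
      rw [← hsum, h', Finset.sum_empty] at this
      exact this.false
  have hne : (P.image w).Nonempty := by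
    rcases lt_or_gt_of_ne hft₀ with h | h
    · exact hiff.2 ⟨_, Finset.mem_image_of_mem w (Finset.mem_filter.2 ⟨ht₀, h⟩)⟩
    · exact ⟨_, Finset.mem_image_of_mem w (Finset.mem_filter.2 ⟨ht₀, h⟩)⟩
  have hdisj : Disjoint (P.image w) (N.image w) := by
    rw [Finset.disjoint_left]
    intro x hx hx'
    obtain ⟨s, hs, rfl⟩ := Finset.mem_image.1 hx
    obtain ⟨t, ht, hst⟩ := Finset.mem_image.1 hx'
    obtain ⟨hs1, hs2⟩ := Finset.mem_filter.1 hs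
    obtain ⟨ht1, ht2⟩ := Finset.mem_filter.1 ht
    obtain rfl := hinj ht1 hs1 hst
    exact hs2.not_gt ht2
  obtain ⟨T', h1, h2, h3⟩ := exists_card_lt_of_sum_eq_sum _ (T.image w) _ _ rfl hwpos hPT hNT
    hdisj hne (hiff.1 hne) hsum
  exact ⟨T', h1, h2.trans_eq heq, fun t ht => mem_span_nnrat_trans (hspan t ht) h3⟩

theorem exists_linearIndepOn_span (n : ℕ) : ∀ X : Finset ℝ, X.card = n → (∀ x ∈ X, 0 < x) →
    ∃ T : Finset ℝ, (∀ t ∈ T, 0 < t) ∧ LinearIndepOn ℚ id (T : Set ℝ) ∧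
      ∀ x ∈ X, x ∈ Submodule.span ℚ≥0 (T : Set ℝ) := by
  induction n using Nat.strong_induction_on with
  | _ n ih =>
    intro X hn hX
    by_cases hind : LinearIndepOn ℚ id (X : Set ℝ)
    · exact ⟨X, hX, hind, fun x hx => Submodule.subset_span hx⟩
    · obtain ⟨T', h1, h2, h3⟩ := exists_card_lt_of_not_linearIndepOn hX hind
      obtain ⟨T, h4, h5, h6⟩ := ih _ (hn ▸ h2) T' rfl h1
      exact ⟨T, h4, h5, fun x hx => mem_span_nnrat_trans (h3 x hx) h6⟩

theorem exists_nsmul_mem_closure_of_mem_span {x : ℝ} {T : Finset ℝ}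
    (h : x ∈ Submodule.span ℚ≥0 (T : Set ℝ)) :
    ∃ N : ℕ, 0 < N ∧ N • x ∈ AddSubmonoid.closure (T : Set ℝ) := by
  induction h using Submodule.span_induction with
  | mem x hx => exact ⟨1, one_pos, by simpa using AddSubmonoid.subset_closure hx⟩
  | zero => exact ⟨1, one_pos, by simp⟩
  | add x y _ _ hx hy =>
    obtain ⟨N, hN, hx⟩ := hx
    obtain ⟨M, hM, hy⟩ := hy
    refine ⟨N * M, by positivity, ?_⟩
    rw [smul_add]
    refine add_mem ?_ ?_
    · rw [mul_comm, mul_smul]; exact nsmul_mem hx _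
    · rw [mul_smul]; exact nsmul_mem hy _
  | smul q x _ hx =>
    obtain ⟨N, hN, hx⟩ := hx
    refine ⟨N * q.den, Nat.mul_pos hN q.den_pos, ?_⟩
    have : (N * q.den) • (q • x) = q.num • (N • x) := by
      have h := NNRat.den_mul_eq_num q
      have h' : ((q.den : ℝ) * (q : ℝ)) = q.num := by exact_mod_cast h
      simp only [nsmul_eq_mul, NNRat.smul_def]
      push_cast
      rw [← h']; ring
    rw [this]
    exact nsmul_mem hx _

theorem exists_common_nsmul_mem_closure (T X : Finset ℝ)
    (h : ∀ x ∈ X, x ∈ Submodule.span ℚ≥0 (T : Set ℝ)) :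
    ∃ N : ℕ, 0 < N ∧ ∀ x ∈ X, N • x ∈ AddSubmonoid.closure (T : Set ℝ) := by
  classical
  induction X using Finset.induction_on with
  | empty => exact ⟨1, one_pos, by simp⟩
  | insert a X _ ih =>
    obtain ⟨N, hN, hx⟩ := ih fun x hx => h x (Finset.mem_insert_of_mem hx)
    obtain ⟨M, hM, ha⟩ := exists_nsmul_mem_closure_of_mem_span (h a (Finset.mem_insert_self _ _))
    refine ⟨N * M, by positivity, fun x hxX => ?_⟩
    rcases Finset.mem_insert.1 hxX with rfl | hxX
    · rw [mul_smul]; exact nsmul_mem ha _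
    · rw [mul_comm, mul_smul]; exact nsmul_mem (hx x hxX) _

/-- Finitely many positive reals are sums of elements of a finite set of `ℚ`-linearly independent
positive reals: the positive cone of a finitely generated subgroup of `ℝ` is a union of
simplicial cones. -/
theorem exists_linearIndepOn_closure (X : Finset ℝ) (hX : ∀ x ∈ X, 0 < x) :
    ∃ T : Finset ℝ, (∀ t ∈ T, 0 < t) ∧ LinearIndepOn ℚ id (T : Set ℝ) ∧
      ∀ x ∈ X, x ∈ AddSubmonoid.closure (T : Set ℝ) := by
  classical
  obtain ⟨T, hT, hind, hspan⟩ := exists_linearIndepOn_span _ X rfl hX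
  obtain ⟨N, hN, hcl⟩ := exists_common_nsmul_mem_closure T X hspan
  have hN' : (0 : ℝ) < N := by exact_mod_cast hN
  refine ⟨T.image (fun t => (N : ℝ)⁻¹ * t), ?_, ?_, ?_⟩
  · intro t ht
    obtain ⟨s, hs, rfl⟩ := Finset.mem_image.1 ht
    exact mul_pos (inv_pos.2 hN') (hT s hs)
  · rw [linearIndepOn_finset_iff] at hind ⊢
    intro f hf t ht
    obtain ⟨s, hs, rfl⟩ := Finset.mem_image.1 ht
    refine hind (fun s => f ((N : ℝ)⁻¹ * s)) ?_ s hs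
    rw [Finset.sum_image (fun a _ b _ hab => mul_left_cancel₀ (inv_pos.2 hN').ne' hab)] at hf
    have : ∑ i ∈ T, f ((N : ℝ)⁻¹ * i) • id i =
        N * ∑ i ∈ T, f ((N : ℝ)⁻¹ * i) • id ((N : ℝ)⁻¹ * i) := by
      rw [Finset.mul_sum]
      refine Finset.sum_congr rfl fun i _ => ?_
      simp only [Rat.smul_def, id]
      field_simp
    rw [this, hf, mul_zero]
  · intro x hx
    have h1 := AddSubmonoid.mem_map_of_mem (AddMonoidHom.mulLeft (N : ℝ)⁻¹) (hcl x hx)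
    rw [AddMonoidHom.map_mclosure] at h1
    have h2 : (AddMonoidHom.mulLeft (N : ℝ)⁻¹) (N • x) = x := by
      simp [hN'.ne']
    rw [h2] at h1
    simpa using h1

/-! ### Subdivisions of intervals -/

/-- The half-open intervals `[pos d, pos d + len d)`, for `d : D`, form a partition
of `[u, v)`. -/
structure IsSubdivision (u v : ℝ) {D : Type} (pos len : D → ℝ) : Prop where
  len_pos : ∀ d, 0 < len d
  le_pos : ∀ d, u ≤ pos d
  add_le : ∀ d, pos d + len d ≤ v
  existsUnique : ∀ t, u ≤ t → t < v → ∃! d, pos d ≤ t ∧ t < pos d + len d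

namespace IsSubdivision

variable {u v w : ℝ} {D E : Type} {pos len : D → ℝ} {pos' len' : E → ℝ}

theorem eq_of_mem (h : IsSubdivision u v pos len) {t : ℝ} {d e : D} (hd : pos d ≤ t)
    (hd' : t < pos d + len d) (he : pos e ≤ t) (he' : t < pos e + len e) : d = e :=
  (h.existsUnique t ((h.le_pos d).trans hd) (hd'.trans_le (h.add_le d))).unique
    ⟨hd, hd'⟩ ⟨he, he'⟩

theorem pos_injective (h : IsSubdivision u v pos len) : Function.Injective pos := by
  intro d e hde
  have h1 := h.len_pos d
  have h2 := h.len_pos e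
  exact h.eq_of_mem (t := pos d) le_rfl (by linarith) hde.ge (by linarith)

theorem end_injective (h : IsSubdivision u v pos len) :
    Function.Injective fun d => pos d + len d := by
  intro d e hde
  simp only at hde
  have h1 := h.len_pos d
  have h2 := h.len_pos e
  exact h.eq_of_mem (t := max (pos d) (pos e)) (le_max_left _ _)
    (max_lt (by linarith) (by linarith)) (le_max_right _ _) (max_lt (by linarith) (by linarith))

/-- The total length is the sum of the lengths, for any additive notion of length. The right end
points are the left end points with `u` replaced by `v`, so that the sum telescopes. -/
theorem sum_len [Fintype D] (h : IsSubdivision u v pos len) (huv : u < v) {G : Type*}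
    [AddCommGroup G] (φ : ℝ →+ G) : ∑ d, φ (len d) = φ (v - u) := by
  classical
  have hv : v ∉ Finset.univ.image pos := by
    intro hv
    obtain ⟨d, -, hd⟩ := Finset.mem_image.1 hv
    have := h.len_pos d
    have := h.add_le d
    linarith
  have hu : u ∈ Finset.univ.image pos := by
    obtain ⟨d, ⟨hd, -⟩, -⟩ := h.existsUnique u le_rfl huv
    exact Finset.mem_image.2 ⟨d, Finset.mem_univ d, hd.antisymm (h.le_pos d)⟩
  have hsub : Finset.univ.image (fun d => pos d + len d) ⊆
      (insert v (Finset.univ.image pos)).erase u := by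
    intro x hx
    obtain ⟨d, -, rfl⟩ := Finset.mem_image.1 hx
    have h1 := h.len_pos d
    have h2 := h.le_pos d
    refine Finset.mem_erase.2 ⟨by linarith, Finset.mem_insert.2 ?_⟩
    rcases (h.add_le d).eq_or_lt with h3 | h3
    · exact Or.inl h3
    · right
      obtain ⟨e, ⟨he, he'⟩, -⟩ := h.existsUnique (pos d + len d) (by linarith) h3
      refine Finset.mem_image.2 ⟨e, Finset.mem_univ e, he.antisymm ?_⟩
      by_contra! hlt
      have := h.eq_of_mem (t := max (pos d) (pos e)) (le_max_left _ _)
        (max_lt (by linarith) hlt) (le_max_right _ _) (max_lt (by linarith) (by linarith))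
      subst this
      linarith
  have heq := Finset.eq_of_subset_of_card_le hsub (by
    rw [Finset.card_erase_of_mem (Finset.mem_insert_of_mem hu), Finset.card_insert_of_notMem hv,
      Finset.card_image_of_injective _ h.pos_injective,
      Finset.card_image_of_injective _ h.end_injective]
    simp)
  have h1 := Finset.add_sum_erase (insert v (Finset.univ.image pos)) φ
    (Finset.mem_insert_of_mem hu)
  rw [← heq, Finset.sum_insert hv, Finset.sum_image h.end_injective.injOn,
    Finset.sum_image h.pos_injective.injOn] at h1
  simp only [map_add, Finset.sum_add_distrib] at h1
  rw [map_sub, eq_sub_iff_add_eq]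
  have h2 : φ u + ∑ d, φ (len d) + ∑ d, φ (pos d) = φ v + ∑ d, φ (pos d) := by
    rw [← h1]; abel
  rw [add_comm]
  exact add_right_cancel h2

theorem append (h : IsSubdivision u v pos len) (h' : IsSubdivision v w pos' len')
    (huv : u ≤ v) (hvw : v ≤ w) :
    IsSubdivision u w (Sum.elim pos pos') (Sum.elim len len') where
  len_pos := by
    rintro (d | d)
    · exact h.len_pos d
    · exact h'.len_pos d
  le_pos := by
    rintro (d | d)
    · exact h.le_pos d
    · exact huv.trans (h'.le_pos d)
  add_le := by
    rintro (d | d)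
    · exact (h.add_le d).trans hvw
    · exact h'.add_le d
  existsUnique := by
    intro t hut htw
    rcases lt_or_ge t v with htv | htv
    · obtain ⟨d, hd, hd'⟩ := h.existsUnique t hut htv
      refine ⟨Sum.inl d, hd, ?_⟩
      rintro (e | e) he
      · exact congrArg _ (hd' e he)
      · exact absurd ((h'.le_pos e).trans he.1) htv.not_ge
    · obtain ⟨d, hd, hd'⟩ := h'.existsUnique t htv htw
      refine ⟨Sum.inr d, hd, ?_⟩
      rintro (e | e) he
      · exact absurd (he.2.trans_le (h.add_le e)) htv.not_gt
      · exact congrArg _ (hd' e he)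

end IsSubdivision

theorem exists_isSubdivision_of_mem_closure {T : Set ℝ} (hT : ∀ t ∈ T, 0 < t) {l : ℝ}
    (hl : l ∈ AddSubmonoid.closure T) :
    0 ≤ l ∧ ∀ u, ∃ (D : Type) (_ : Fintype D) (pos len : D → ℝ),
      IsSubdivision u (u + l) pos len ∧ ∀ d, len d ∈ T := by
  induction hl using AddSubmonoid.closure_induction with
  | mem l hl =>
    refine ⟨(hT l hl).le, fun u => ⟨Unit, inferInstance, fun _ => u, fun _ => l,
      ⟨fun _ => hT l hl, fun _ => le_rfl, fun _ => le_rfl,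
        fun t h1 h2 => ⟨(), ⟨h1, h2⟩, fun _ _ => rfl⟩⟩, fun _ => hl⟩⟩
  | zero =>
    refine ⟨le_rfl, fun u => ⟨Empty, inferInstance, Empty.elim, Empty.elim,
      ⟨fun d => d.elim, fun d => d.elim, fun d => d.elim, fun t h1 h2 => ?_⟩, fun d => d.elim⟩⟩
    linarith
  | add x y _ _ hx hy =>
    refine ⟨add_nonneg hx.1 hy.1, fun u => ?_⟩
    obtain ⟨D, _, pos, len, h, hl⟩ := hx.2 u
    obtain ⟨D', _, pos', len', h', hl'⟩ := hy.2 (u + x)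
    have h1 := hx.1
    have h2 := hy.1
    refine ⟨D ⊕ D', inferInstance, _, _, add_assoc u x y ▸ h.append h' (by linarith) (by linarith),
      ?_⟩
    rintro (d | d)
    · exact hl d
    · exact hl' d

/-- If the differences of the points of `B` are sums of elements of `T`, then an interval between two
of these points has a subdivision with lengths in `T` that refines the one given by `B`. -/
theorem exists_isSubdivision_of_sub_mem_closure {T : Set ℝ} (hT : ∀ t ∈ T, 0 < t)
    (B : Finset ℝ) (hB : ∀ a ∈ B, ∀ b ∈ B, a < b → b - a ∈ AddSubmonoid.closure T) (n : ℕ) :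
    ∀ u ∈ B, ∀ v ∈ B, u < v → (B.filter fun b => u < b ∧ b < v).card = n →
    ∃ (D : Type) (_ : Fintype D) (pos len : D → ℝ), IsSubdivision u v pos len ∧
      (∀ d, len d ∈ T) ∧ ∀ b ∈ B, u ≤ b → b < v → ∃ d, pos d = b := by
  induction n using Nat.strong_induction_on with
  | _ n ih =>
    intro u hu v hv huv hn
    by_cases hex : ∃ b ∈ B, u < b ∧ b < v
    · obtain ⟨b, hb, hub, hbv⟩ := hex
      obtain ⟨D, _, pos, len, h1, h2, h3⟩ := ih _ (hn ▸ Finset.card_lt_card (by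
        rw [Finset.ssubset_iff_of_subset]
        · exact ⟨b, by simp [hb, hub, hbv], by simp⟩
        · intro x hx
          simp only [Finset.mem_filter] at hx ⊢
          exact ⟨hx.1, hx.2.1, hx.2.2.trans hbv⟩)) u hu b hb hub rfl
      obtain ⟨D', _, pos', len', h1', h2', h3'⟩ := ih _ (hn ▸ Finset.card_lt_card (by
        rw [Finset.ssubset_iff_of_subset]
        · exact ⟨b, by simp [hb, hub, hbv], by simp⟩
        · intro x hx
          simp only [Finset.mem_filter] at hx ⊢
          exact ⟨hx.1, hub.trans hx.2.1, hx.2.2⟩)) b hb v hv hbv rfl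
      refine ⟨D ⊕ D', inferInstance, _, _, h1.append h1' hub.le hbv.le, ?_, ?_⟩
      · rintro (d | d)
        · exact h2 d
        · exact h2' d
      · intro x hx hux hxv
        rcases lt_or_ge x b with hxb | hxb
        · obtain ⟨d, hd⟩ := h3 x hx hux hxb
          exact ⟨Sum.inl d, hd⟩
        · obtain ⟨d, hd⟩ := h3' x hx hxb hxv
          exact ⟨Sum.inr d, hd⟩
    · push Not at hex
      obtain ⟨D, _, pos, len, h1, h2⟩ :=
        (exists_isSubdivision_of_mem_closure hT (hB u hu v hv huv)).2 u
      rw [add_sub_cancel] at h1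
      refine ⟨D, inferInstance, pos, len, h1, h2, fun b hb hub hbv => ?_⟩
      obtain rfl : u = b := hub.eq_or_lt.resolve_right fun h => (hex b hb h).not_gt hbv
      obtain ⟨d, ⟨hd, -⟩, -⟩ := h1.existsUnique u le_rfl huv
      exact ⟨d, hd.antisymm (h1.le_pos d)⟩

/-- Any finite set of points of `[0,1)` consists of left end points of some subdivision into
intervals whose distinct lengths are linearly independent over `ℚ`. -/
theorem exists_isSubdivision_linearIndepOn (B : Finset ℝ) :
    ∃ (D : Type) (_ : Fintype D) (pos len : D → ℝ), IsSubdivision 0 1 pos len ∧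
      LinearIndepOn ℚ id (Set.range len) ∧ ∀ b ∈ B, 0 ≤ b → b < 1 → ∃ d, pos d = b := by
  classical
  set B' : Finset ℝ := insert 0 (insert 1 B) with hB'
  obtain ⟨T, hT, hind, hcl⟩ := exists_linearIndepOn_closure
    (((B' ×ˢ B').filter fun p => p.1 < p.2).image fun p => p.2 - p.1) (by
      intro x hx
      obtain ⟨p, hp, rfl⟩ := Finset.mem_image.1 hx
      exact sub_pos.2 (Finset.mem_filter.1 hp).2)
  obtain ⟨D, hD, pos, len, h1, h2, h3⟩ := exists_isSubdivision_of_sub_mem_closure (T := T) hT B'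
    (fun a ha b hb hab => hcl _ (Finset.mem_image.2 ⟨(a, b), by simp [ha, hb, hab], rfl⟩)) _
    0 (by simp [hB']) 1 (by simp [hB']) one_pos rfl
  exact ⟨D, hD, pos, len, h1, hind.mono (by rintro _ ⟨d, rfl⟩; exact h2 d),
    fun b hb => h3 b (by simp [hB', hb])⟩

/-- By independence of the lengths, two subdivisions of `[0,1)` with lengths from the same
independent set use each length equally often. -/
theorem IsSubdivision.exists_equiv {D E : Type} [Fintype D] [Fintype E] {pos len : D → ℝ}
    {pos' len' : E → ℝ} (h : IsSubdivision 0 1 pos len) (h' : IsSubdivision 0 1 pos' len')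
    (hind : LinearIndepOn ℚ id (Set.range len)) (hsub : ∀ e, len' e ∈ Set.range len) :
    ∃ ρ : E ≃ D, ∀ e, len (ρ e) = len' e := by
  classical
  have hcard : ∀ a, Fintype.card {e // len' e = a} = Fintype.card {d // len d = a} := by
    intro a
    by_cases ha : a ∈ Set.range len
    · set b := Module.Basis.extend hind with hb
      have hext := hind.subset_extend (Set.subset_univ _)
      set φ : ℝ →ₗ[ℚ] ℚ := b.coord ⟨a, hext ha⟩ with hφ
      have hφ' : ∀ x ∈ Set.range len, φ x = if x = a then 1 else 0 := by
        intro x hx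
        have : b ⟨x, hext hx⟩ = x := by simp [hb]
        conv_lhs => rw [← this]
        rw [hφ, Module.Basis.coord_apply, Module.Basis.repr_self, Finsupp.single_apply]
        simp
      have h1 := h.sum_len one_pos φ.toAddMonoidHom
      have h2 := h'.sum_len one_pos φ.toAddMonoidHom
      rw [← h1] at h2
      simp only [LinearMap.toAddMonoidHom_coe] at h2
      rw [Finset.sum_congr rfl fun e _ => hφ' _ (hsub e),
        Finset.sum_congr rfl fun d _ => hφ' _ ⟨d, rfl⟩] at h2
      simp only [Finset.sum_boole] at h2
      rw [Fintype.card_subtype, Fintype.card_subtype]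
      exact_mod_cast h2
    · rw [Fintype.card_eq_zero_iff.2 ⟨fun e : {e // len' e = a} => ha (e.2 ▸ hsub e.1)⟩,
        Fintype.card_eq_zero_iff.2 ⟨fun d : {d // len d = a} => ha ⟨d.1, d.2⟩⟩]
  exact ⟨Equiv.ofFiberEquiv (f := len') (g := len) fun a => Fintype.equivOfCardEq (hcard a),
    fun e => Equiv.ofFiberEquiv_map _ _⟩

namespace IsSubdivision

variable {D : Type} {pos len : D → ℝ}

/-- The index of the interval of the subdivision that contains `t`. -/
noncomputable def slot (h : IsSubdivision 0 1 pos len) (t : Set.Ico (0 : ℝ) 1) : D :=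
  (h.existsUnique t t.2.1 t.2.2).choose

theorem pos_slot_le (h : IsSubdivision 0 1 pos len) (t : Set.Ico (0 : ℝ) 1) :
    pos (h.slot t) ≤ t := (h.existsUnique t t.2.1 t.2.2).choose_spec.1.1

theorem lt_pos_slot_add (h : IsSubdivision 0 1 pos len) (t : Set.Ico (0 : ℝ) 1) :
    t < pos (h.slot t) + len (h.slot t) := (h.existsUnique t t.2.1 t.2.2).choose_spec.1.2

theorem slot_eq (h : IsSubdivision 0 1 pos len) {t : Set.Ico (0 : ℝ) 1} {d : D}
    (h1 : pos d ≤ t) (h2 : t < pos d + len d) : h.slot t = d :=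
  h.eq_of_mem (h.pos_slot_le t) (h.lt_pos_slot_add t) h1 h2

/-- The point of the interval with index `d` in the same relative position as the point `t` in its
own interval, which is assumed to have the same length. -/
noncomputable def move (h : IsSubdivision 0 1 pos len) (d : D) (t : Set.Ico (0 : ℝ) 1)
    (hd : len d = len (h.slot t)) : Set.Ico (0 : ℝ) 1 :=
  ⟨pos d + (t - pos (h.slot t)), by
    have h1 := h.pos_slot_le t
    have h2 := h.lt_pos_slot_add t
    have h3 := h.le_pos d
    have h4 := h.add_le d
    constructor <;> linarith⟩

theorem coe_move (h : IsSubdivision 0 1 pos len) (d : D) (t : Set.Ico (0 : ℝ) 1)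
    (hd : len d = len (h.slot t)) : (h.move d t hd : ℝ) = pos d + (t - pos (h.slot t)) := rfl

@[simp] theorem slot_move (h : IsSubdivision 0 1 pos len) (d : D) (t : Set.Ico (0 : ℝ) 1)
    (hd : len d = len (h.slot t)) : h.slot (h.move d t hd) = d := by
  have h1 := h.pos_slot_le t
  have h2 := h.lt_pos_slot_add t
  apply h.slot_eq <;> rw [coe_move] <;> linarith

/-- Points of the same interval lie on the same side of each left end point. -/
theorem pos_le_iff_of_slot_eq (h : IsSubdivision 0 1 pos len) {t t' : Set.Ico (0 : ℝ) 1}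
    (ht : h.slot t = h.slot t') (d : D) : pos d ≤ t ↔ pos d ≤ t' := by
  have key : ∀ t t' : Set.Ico (0 : ℝ) 1, h.slot t = h.slot t' → pos d ≤ t → pos d ≤ t' := by
    intro t t' ht hd
    by_contra! hlt
    have h1 := h.pos_slot_le t'
    have h2 := h.lt_pos_slot_add t
    have h3 := h.len_pos d
    rw [ht] at h2
    have := h.eq_of_mem (t := pos d) le_rfl (by linarith) (h1.trans hlt.le) (hd.trans_lt h2)
    rw [← this] at h1
    exact hlt.not_ge h1
  exact ⟨key t t' ht, key t' t ht.symm⟩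

end IsSubdivision

theorem finite_range_of_factors {α β γ : Type*} {F : α → β} (σ : α → γ)
    (hσ : (Set.range σ).Finite) (h : ∀ x y, σ x = σ y → F x = F y) : (Set.range F).Finite := by
  rcases isEmpty_or_nonempty α with hα | ⟨⟨a⟩⟩
  · rw [Set.range_eq_empty]; exact Set.finite_empty
  · refine (hσ.image (Function.extend σ F fun _ => F a)).subset ?_
    rintro _ ⟨x, rfl⟩
    exact ⟨σ x, ⟨x, rfl⟩,
      Function.FactorsThrough.extend_apply (fun {x y} hxy => h x y hxy) _ x⟩

/-- A map of `[0,1)` to itself which is a translation on each interval of a finite partition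
into half-open intervals: its displacement at `t` depends only on which elements of some finite
set `B` are at most `t`. -/
def IsPiecewiseTranslation (c : Set.Ico (0 : ℝ) 1 → Set.Ico (0 : ℝ) 1) : Prop :=
  ∃ B : Finset ℝ, ∀ t t' : Set.Ico (0 : ℝ) 1, (∀ b ∈ B, b ≤ (t : ℝ) ↔ b ≤ (t' : ℝ)) →
    (c t : ℝ) - t = c t' - t'

theorem IsPiecewiseTranslation.finite_range {c : Set.Ico (0 : ℝ) 1 → Set.Ico (0 : ℝ) 1}
    (h : IsPiecewiseTranslation c) : (Set.range fun t => (c t : ℝ) - t).Finite := by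
  classical
  obtain ⟨B, hB⟩ := h
  refine finite_range_of_factors (fun t : Set.Ico (0 : ℝ) 1 => B.filter (· ≤ (t : ℝ)))
    (B.powerset.finite_toSet.subset ?_) ?_
  · rintro _ ⟨t, rfl⟩
    exact Finset.mem_coe.2 (Finset.mem_powerset.2 (Finset.filter_subset _ _))
  · intro t t' h
    refine hB t t' fun b hb => ?_
    have := Finset.ext_iff.1 h b
    simpa [hb] using this

/-- Suppose that `c` maps, by translations, each of finitely many consecutive intervals onto an
interval of the given subdivision, whose lengths are independent. Then the consecutive intervals
can be rearranged into the slots of the subdivision, each going to a slot of its own length. The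
rearrangement exists since both partitions of `[0,1)` use each length equally often. -/
theorem IsSubdivision.exists_sorting {D : Type} [Fintype D] {pos len : D → ℝ}
    (h : IsSubdivision 0 1 pos len) (hind : LinearIndepOn ℚ id (Set.range len))
    (c : Set.Ico (0 : ℝ) 1 → Set.Ico (0 : ℝ) 1) (hc : IsPiecewiseTranslation c)
    (hcoh : ∀ τ t', h.slot t' = h.slot (c τ) →
      ∃ τ', c τ' = t' ∧ (τ' : ℝ) - τ = t' - c τ) :
    ∃ s : Equiv.Perm (Set.Ico (0 : ℝ) 1), IsPiecewiseTranslation s ∧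
      (∀ τ τ', h.slot (c τ) = h.slot (c τ') → (τ' : ℝ) - τ = c τ' - c τ →
        h.slot (s τ) = h.slot (s τ')) ∧
      ∀ τ, len (h.slot (s τ)) = len (h.slot (c τ)) ∧
        (s τ : ℝ) - pos (h.slot (s τ)) = c τ - pos (h.slot (c τ)) := by
  classical
  set E := {τ : Set.Ico (0 : ℝ) 1 // ∃ d, (c τ : ℝ) = pos d} with hE
  have hEfin : Finite E := by
    have h1 : (Set.image2 (fun d v => pos d - v) Set.univ
      (Set.range fun t => (c t : ℝ) - t)).Finite := Set.finite_univ.image2 _ hc.finite_range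
    have h2 : ∀ e : E, ((e : Set.Ico (0 : ℝ) 1) : ℝ) ∈ Set.image2 (fun d v => pos d - v) Set.univ
        (Set.range fun t => (c t : ℝ) - t) := by
      rintro ⟨τ, d, hd⟩
      exact ⟨d, trivial, _, ⟨τ, rfl⟩, by simp only; linarith⟩
    have := h1.to_subtype
    exact Finite.of_injective (fun e : E => (⟨_, h2 e⟩ : Set.image2 (fun d v => pos d - v) Set.univ
      (Set.range fun t => (c t : ℝ) - t)))
      fun e e' hee => Subtype.ext (Subtype.ext (by simpa using hee))
  have := Fintype.ofFinite E
  set pos' : E → ℝ := fun e => (e : Set.Ico (0 : ℝ) 1) with hpos'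
  set len' : E → ℝ := fun e => len (h.slot (c e)) with hlen'
  have hcE : ∀ e : E, (c e : ℝ) = pos (h.slot (c e)) := by
    rintro ⟨τ, d, hd⟩
    have := h.len_pos d
    rw [h.slot_eq hd.ge (by linarith), hd]
  -- The points above a slot form an interval that starts at an element of `E`.
  have hfollow : ∀ (e : E) (x : ℝ), pos' e ≤ x → x < pos' e + len' e →
      ∃ τ : Set.Ico (0 : ℝ) 1, (τ : ℝ) = x ∧ h.slot (c τ) = h.slot (c e) ∧
        (c τ : ℝ) - pos (h.slot (c τ)) = x - pos' e := by
    intro e x hx1 hx2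
    have h1 := h.le_pos (h.slot (c e))
    have h2 := h.add_le (h.slot (c e))
    have h3 : h.slot ⟨pos (h.slot (c e)) + (x - pos' e), by
        constructor <;> linarith⟩ = h.slot (c e) :=
      h.slot_eq (by simp only; linarith) (by simp only [hlen'] at *; linarith)
    obtain ⟨τ, hτ, hτ'⟩ := hcoh e _ h3
    refine ⟨τ, ?_, by rw [hτ, h3], by rw [hτ, h3]; simp⟩
    have := hcE e
    simp only [hpos'] at hτ'
    linarith
  have hstart : ∀ τ : Set.Ico (0 : ℝ) 1, ∃ e : E,
      pos' e = τ - (c τ - pos (h.slot (c τ))) ∧ h.slot (c e) = h.slot (c τ) := by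
    intro τ
    have h1 := h.le_pos (h.slot (c τ))
    have h2 := h.add_le (h.slot (c τ))
    have h3 := h.len_pos (h.slot (c τ))
    have h4 : h.slot ⟨pos (h.slot (c τ)), by constructor <;> linarith⟩ = h.slot (c τ) :=
      h.slot_eq le_rfl (by simp only; linarith)
    obtain ⟨τ', hτ, hτ'⟩ := hcoh τ _ h4
    refine ⟨⟨τ', _, congrArg Subtype.val hτ⟩, ?_, ?_⟩
    · simp only [hpos'] at *
      linarith
    · simp only
      rw [hτ, h4]
  choose st hst hst' using hstart
  have huniq : ∀ (τ : Set.Ico (0 : ℝ) 1) (e : E), pos' e ≤ τ → (τ : ℝ) < pos' e + len' e →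
      e = st τ := by
    intro τ e he he'
    obtain ⟨τ', h1, h2, h3⟩ := hfollow e τ he he'
    obtain rfl : τ' = τ := Subtype.ext h1
    have : pos' e = pos' (st τ') := by rw [hst τ']; linarith
    exact Subtype.ext (Subtype.ext this)
  have hmem : ∀ τ : Set.Ico (0 : ℝ) 1, pos' (st τ) ≤ τ ∧
      (τ : ℝ) < pos' (st τ) + len' (st τ) := by
    intro τ
    have h1 := h.pos_slot_le (c τ)
    have h2 := h.lt_pos_slot_add (c τ)
    simp only [hst, hlen', hst']
    constructor <;> linarith
  have hsub : IsSubdivision 0 1 pos' len' := by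
    refine ⟨fun e => h.len_pos _, fun e => e.1.2.1, fun e => ?_, fun t h0 h1 => ?_⟩
    · by_contra! hlt
      obtain ⟨τ, hτ, -⟩ := hfollow e 1 e.1.2.2.le hlt
      exact τ.2.2.ne hτ
    · exact ⟨st ⟨t, h0, h1⟩, hmem ⟨t, h0, h1⟩, fun e he => huniq ⟨t, h0, h1⟩ e he.1 he.2⟩
  obtain ⟨ρ, hρ⟩ := h.exists_equiv hsub hind fun e => ⟨_, rfl⟩
  have hlen : ∀ τ, len (ρ (st τ)) = len (h.slot (c τ)) := by
    intro τ
    rw [hρ, hlen']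
    simp only
    rw [hst']
  set s : Set.Ico (0 : ℝ) 1 → Set.Ico (0 : ℝ) 1 :=
    fun τ => h.move (ρ (st τ)) (c τ) (hlen τ) with hs
  have hslot : ∀ τ, h.slot (s τ) = ρ (st τ) := fun τ => h.slot_move _ _ _
  have hcoe : ∀ τ, (s τ : ℝ) = pos (ρ (st τ)) + (τ - pos' (st τ)) := by
    intro τ
    simp only [hs, IsSubdivision.coe_move, hst]
    ring
  have hbij : Function.Bijective s := by
    constructor
    · intro τ τ' hττ
      have h1 : st τ = st τ' := ρ.injective (by rw [← hslot, ← hslot, hττ])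
      have h2 := hcoe τ
      rw [hττ, hcoe, h1] at h2
      exact Subtype.ext (by linarith)
    · intro t
      set e := ρ.symm (h.slot t) with he
      have h1 := h.pos_slot_le t
      have h2 := h.lt_pos_slot_add t
      have h3 : len' e = len (h.slot t) := by rw [← hρ e, he, Equiv.apply_symm_apply]
      obtain ⟨τ, hτ, -, -⟩ := hfollow e (pos' e + (t - pos (h.slot t))) (by linarith)
        (by linarith)
      have h4 := huniq τ e (by linarith) (by linarith)
      refine ⟨τ, Subtype.ext ?_⟩
      rw [hcoe, ← h4, hτ, he, Equiv.apply_symm_apply]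
      ring
  refine ⟨Equiv.ofBijective s hbij, ⟨Finset.univ.image pos', fun t t' htt => ?_⟩, ?_, ?_⟩
  · have h1 : pos' (st t) ≤ t' := (htt _ (by simp)).1 (hmem t).1
    have h2 : pos' (st t') ≤ t := (htt _ (by simp)).2 (hmem t').1
    have h3 : st t = st t' := by
      have h4 := (hmem t).2
      have h5 := (hmem t').2
      rcases le_total (pos' (st t)) (pos' (st t')) with h6 | h6
      · exact hsub.eq_of_mem (t := pos' (st t')) h6 (by linarith) le_rfl
          (by linarith [hsub.len_pos (st t')])
      · exact hsub.eq_of_mem (t := pos' (st t)) le_rfl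
          (by linarith [hsub.len_pos (st t)]) h6 (by linarith)
    simp only [Equiv.ofBijective_apply, hcoe, h3]
    ring
  · intro τ τ' h1 h2
    have h3 : st τ = st τ' := by
      refine Subtype.ext (Subtype.ext ?_)
      have h4 := hst τ
      have h5 := hst τ'
      simp only [hpos'] at h4 h5
      rw [h1] at h4
      linarith
    simp only [Equiv.ofBijective_apply, hslot, h3]
  · intro τ
    simp only [Equiv.ofBijective_apply]
    refine ⟨by rw [hslot, hlen], ?_⟩
    rw [hslot, hcoe, hst]
    ring

/-! ### Interval exchanges -/

/-- The restricted rotation with parameters `a < b < c`. -/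
noncomputable def rotation (a b c : ℝ) (ha : 0 ≤ a) (hab : a < b) (hbc : b < c) (hc : c ≤ 1) :
    Equiv.Perm (Set.Ico (0 : ℝ) 1) where
  toFun t := if h1 : a ≤ (t : ℝ) ∧ (t : ℝ) < b then
      ⟨t + (c - b), by constructor <;> linarith [t.2.1, t.2.2]⟩
    else if h2 : b ≤ (t : ℝ) ∧ (t : ℝ) < c then
      ⟨t - (b - a), by constructor <;> linarith [t.2.1, t.2.2]⟩
    else t
  invFun t := if h1 : a ≤ (t : ℝ) ∧ (t : ℝ) < a + (c - b) then
      ⟨t + (b - a), by constructor <;> linarith [t.2.1, t.2.2]⟩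
    else if h2 : a + (c - b) ≤ (t : ℝ) ∧ (t : ℝ) < c then
      ⟨t - (c - b), by constructor <;> linarith [t.2.1, t.2.2]⟩
    else t
  left_inv t := by
    apply Subtype.ext
    dsimp only
    split_ifs <;> grind
  right_inv t := by
    apply Subtype.ext
    dsimp only
    split_ifs <;> grind

theorem rotation_symm_of_lt {a b c : ℝ} (ha : 0 ≤ a) (hab : a < b) (hbc : b < c) (hc : c ≤ 1)
    (t : Set.Ico (0 : ℝ) 1) (h1 : a ≤ (t : ℝ)) (h2 : (t : ℝ) < a + (c - b)) :
    ((rotation a b c ha hab hbc hc).symm t : ℝ) = t + (b - a) := by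
  simp [rotation, h1, h2]

theorem rotation_symm_of_ge {a b c : ℝ} (ha : 0 ≤ a) (hab : a < b) (hbc : b < c) (hc : c ≤ 1)
    (t : Set.Ico (0 : ℝ) 1) (h1 : a + (c - b) ≤ (t : ℝ)) (h2 : (t : ℝ) < c) :
    ((rotation a b c ha hab hbc hc).symm t : ℝ) = t - (c - b) := by
  simp [rotation, h1.not_gt, h1, h2]

theorem rotation_symm_of_notMem {a b c : ℝ} (ha : 0 ≤ a) (hab : a < b) (hbc : b < c) (hc : c ≤ 1)
    (t : Set.Ico (0 : ℝ) 1) (h : (t : ℝ) < a ∨ c ≤ (t : ℝ)) :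
    (rotation a b c ha hab hbc hc).symm t = t := by
  have h1 : ¬ (a ≤ (t : ℝ) ∧ (t : ℝ) < a + (c - b)) := by
    rintro ⟨h1, h2⟩
    rcases h with h | h <;> linarith
  have h2 : ¬ (a + (c - b) ≤ (t : ℝ) ∧ (t : ℝ) < c) := by
    rintro ⟨h1, h2⟩
    rcases h with h | h <;> linarith
  simp only [rotation, Equiv.coe_fn_symm_mk, dif_neg h1, dif_neg h2]

theorem isRestrictedRotation_rotation {a b c : ℝ} (ha : 0 ≤ a) (hab : a < b) (hbc : b < c)
    (hc : c ≤ 1) : IsRestrictedRotation (rotation a b c ha hab hbc hc) := by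
  refine ⟨a, b, c, ha, hab, hbc, hc, fun t => ⟨?_, ?_, ?_⟩⟩
  · rintro ⟨h1, h2⟩
    simp [rotation, h1, h2]
  · rintro ⟨h1, h2⟩
    simp [rotation, h1, h2, h1.not_gt]
  · intro h
    have h1 : ¬ (a ≤ (t : ℝ) ∧ (t : ℝ) < b) := fun h' => h ⟨h'.1, h'.2.trans hbc⟩
    have h2 : ¬ (b ≤ (t : ℝ) ∧ (t : ℝ) < c) := fun h' => h ⟨hab.le.trans h'.1, h'.2⟩
    simp only [rotation, Equiv.coe_fn_mk, dif_neg h1, dif_neg h2]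

/-- The next element of `B` after `p`, or `1`. -/
theorem exists_next (B : Finset ℝ) (p : ℝ) (hp : p < 1) :
    ∃ q, p < q ∧ q ≤ 1 ∧ (q ∈ B ∨ q = 1) ∧ ∀ b ∈ B, p < b → b < 1 → q ≤ b := by
  classical
  set S := insert 1 (B.filter fun b => p < b ∧ b < 1) with hS
  have hne : S.Nonempty := ⟨1, Finset.mem_insert_self _ _⟩
  have hmin := Finset.min'_mem S hne
  refine ⟨S.min' hne, ?_, S.min'_le 1 (Finset.mem_insert_self _ _), ?_, ?_⟩
  · rcases Finset.mem_insert.1 hmin with h | h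
    · rw [h]; exact hp
    · exact (Finset.mem_filter.1 h).2.1
  · rcases Finset.mem_insert.1 hmin with h | h
    · exact Or.inr h
    · exact Or.inl (Finset.mem_filter.1 h).1
  · intro b hb h1 h2
    exact S.min'_le b (Finset.mem_insert_of_mem (Finset.mem_filter.2 ⟨hb, h1, h2⟩))

/-- An interval exchange that is the identity on `[0,u)`, with breakpoints `B` in `[u,1)`. A
restricted rotation brings the interval that starts at the preimage of `u` to its place, and
one breakpoint disappears. -/
theorem mem_closure_of_eqOn_Iio (n : ℕ) : ∀ (B : Finset ℝ) (u : ℝ)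
    (s : Equiv.Perm (Set.Ico (0 : ℝ) 1)), B.card ≤ n → 0 ≤ u →
    (∀ t : Set.Ico (0 : ℝ) 1, (t : ℝ) < u → s t = t) →
    (∀ t t' : Set.Ico (0 : ℝ) 1, u ≤ (t : ℝ) → u ≤ (t' : ℝ) →
      (∀ b ∈ B, b ≤ (t : ℝ) ↔ b ≤ (t' : ℝ)) → (s t : ℝ) - t = s t' - t') →
    s ∈ Subgroup.closure {s | IsRestrictedRotation s} := by
  classical
  induction n with
  | zero =>
    intro B u s hB hu hid hdisp
    obtain rfl : B = ∅ := Finset.card_eq_zero.1 (Nat.le_zero.1 hB)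
    have hge : ∀ t : Set.Ico (0 : ℝ) 1, u ≤ (t : ℝ) → u ≤ (s t : ℝ) := by
      intro t ht
      by_contra! hlt
      have := s.injective (hid _ hlt)
      rw [this] at hlt
      exact hlt.not_ge ht
    suffices s = 1 by rw [this]; exact one_mem _
    ext t
    rcases lt_or_ge (t : ℝ) u with htu | htu
    · rw [hid t htu]; rfl
    · have hu1 : u < 1 := htu.trans_lt t.2.2
      set z : Set.Ico (0 : ℝ) 1 := ⟨u, hu, hu1⟩ with hz
      have hp : u ≤ (s.symm z : ℝ) := by
        by_contra! hlt
        have := hid _ hlt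
        rw [Equiv.apply_symm_apply] at this
        rw [← this] at hlt
        exact hlt.false
      have h1 := hdisp (s.symm z) z hp le_rfl (by simp)
      have h2 := hge z le_rfl
      have h3 := hdisp t z htu le_rfl (by simp)
      rw [Equiv.apply_symm_apply] at h1
      simp only [hz] at *
      rw [Equiv.Perm.one_apply]
      linarith
  | succ n ih =>
    intro B u s hB hu hid hdisp
    rcases le_or_gt 1 u with hu1 | hu1
    · have : s = 1 := Equiv.ext fun t => hid t (t.2.2.trans_le hu1)
      rw [this]; exact one_mem _
    have hge : ∀ t : Set.Ico (0 : ℝ) 1, u ≤ (t : ℝ) → u ≤ (s t : ℝ) := by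
      intro t ht
      by_contra! hlt
      have := s.injective (hid _ hlt)
      rw [this] at hlt
      exact hlt.not_ge ht
    set z : Set.Ico (0 : ℝ) 1 := ⟨u, hu, hu1⟩ with hz
    set p := s.symm z with hpdef
    have hsp : s p = z := s.apply_symm_apply z
    have hp : u ≤ (p : ℝ) := by
      by_contra! hlt
      have := hid _ hlt
      rw [hsp] at this
      rw [← this] at hlt
      exact hlt.false
    obtain ⟨q, hpq, hq1, hqB, hqmin⟩ := exists_next B p p.2.2
    have hdispq : ∀ t : Set.Ico (0 : ℝ) 1, (p : ℝ) ≤ t → (t : ℝ) < q → (s t : ℝ) = t - (p - u) := by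
      intro t h1 h2
      have := hdisp p t hp (hp.trans h1) fun b hb =>
        ⟨fun h => h.trans h1, fun h => by
          by_contra! hlt
          have := hqmin b hb hlt (h.trans_lt t.2.2)
          linarith⟩
      rw [hsp] at this
      simp only [hz] at this
      linarith
    rcases hp.eq_or_lt with hpu | hpu
    · -- The map is the identity up to the next breakpoint.
      by_cases hqB' : q ∈ B
      · refine ih (B.erase q) q s ?_ (hu.trans (hp.trans hpq.le)) ?_ ?_
        · have := Finset.card_erase_add_one hqB'
          omega
        · intro t ht
          rcases lt_or_ge (t : ℝ) u with htu | htu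
          · exact hid t htu
          · apply Subtype.ext
            rw [hdispq t (hpu ▸ htu) ht, ← hpu]
            ring
        · intro t t' ht ht' htt
          refine hdisp t t' (hp.trans (hpq.le.trans ht)) (hp.trans (hpq.le.trans ht'))
            fun b hb => ?_
          by_cases hbq : b = q
          · subst hbq
            exact iff_of_true ht ht'
          · exact htt b (Finset.mem_erase.2 ⟨hbq, hb⟩)
      · have hq : q = 1 := hqB.resolve_left hqB'
        have : s = 1 := Equiv.ext fun t => by
          rcases lt_or_ge (t : ℝ) u with htu | htu
          · exact hid t htu
          · apply Subtype.ext
            rw [hdispq t (hpu ▸ htu) (hq ▸ t.2.2), ← hpu, Equiv.Perm.one_apply]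
            ring
        rw [this]; exact one_mem _
    · -- Just left of `p` the map cannot have the displacement it has at `p`.
      have hpB : (p : ℝ) ∈ B := by
        by_contra hpB
        set S := insert u (B.filter fun b => u < b ∧ b < p) with hS
        have hne : S.Nonempty := ⟨u, Finset.mem_insert_self _ _⟩
        have hur : u ≤ S.max' hne := S.le_max' u (Finset.mem_insert_self _ _)
        have hrp : S.max' hne < p := by
          rcases Finset.mem_insert.1 (S.max'_mem hne) with h | h
          · rw [h]; exact hpu
          · exact (Finset.mem_filter.1 h).2.2
        set r : Set.Ico (0 : ℝ) 1 := ⟨S.max' hne, hu.trans hur, hrp.trans p.2.2⟩ with hr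
        have h1 := hdisp r p hur hp fun b hb => by
          refine ⟨fun h => h.trans hrp.le, fun h => ?_⟩
          rcases le_or_gt b u with hbu | hbu
          · exact hbu.trans hur
          · exact S.le_max' b (Finset.mem_insert_of_mem (Finset.mem_filter.2
              ⟨hb, hbu, h.lt_of_ne fun h' => hpB (h' ▸ hb)⟩))
        have h2 := hge r hur
        rw [hsp] at h1
        simp only [hz, hr] at *
        linarith
      set ρ := rotation u p q hu hpu hpq hq1 with hρ
      suffices h : s * ρ⁻¹ ∈ Subgroup.closure {s | IsRestrictedRotation s} by
        have h1 : ρ ∈ Subgroup.closure {s | IsRestrictedRotation s} :=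
          Subgroup.subset_closure (isRestrictedRotation_rotation hu hpu hpq hq1)
        simpa using mul_mem h h1
      have happ : ∀ t, (s * ρ⁻¹) t = s (ρ.symm t) := fun t => rfl
      refine ih (((B.filter (· < (p : ℝ))).image (· + (q - p))) ∪ B.filter ((p : ℝ) < ·))
        (u + (q - p)) (s * ρ⁻¹) ?_ (by linarith) ?_ ?_
      · have h1 : (B.filter (· < (p : ℝ))).card + (B.filter ((p : ℝ) < ·)).card < B.card := by
          rw [← Finset.card_union_of_disjoint]
          · refine Finset.card_lt_card ((Finset.ssubset_iff_of_subset ?_).2 ⟨p, hpB, by simp⟩)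
            exact Finset.union_subset (Finset.filter_subset _ _) (Finset.filter_subset _ _)
          · rw [Finset.disjoint_filter]
            intro x _ h h'
            exact h.not_gt h'
        have h2 := Finset.card_union_le ((B.filter (· < (p : ℝ))).image (· + (q - p)))
          (B.filter ((p : ℝ) < ·))
        have h3 := Finset.card_image_le (s := B.filter (· < (p : ℝ))) (f := (· + (q - p)))
        omega
      · intro t ht
        rw [happ]
        rcases lt_or_ge (t : ℝ) u with htu | htu
        · rw [rotation_symm_of_notMem hu hpu hpq hq1 t (Or.inl htu), hid t htu]
        · have h1 := rotation_symm_of_lt hu hpu hpq hq1 t htu ht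
          apply Subtype.ext
          rw [hdispq _ (by rw [h1]; linarith) (by rw [h1]; linarith), h1]
          ring
      · -- On `[u + (q - p), q)` the rotation moves points of `[u, p)`, from `q` on it is trivial.
        intro t t' ht ht' htt
        rw [happ, happ]
        have hlow : ∀ t : Set.Ico (0 : ℝ) 1, u + (q - p) ≤ (t : ℝ) → (t : ℝ) < q →
            (ρ.symm t : ℝ) = t - (q - p) :=
          fun t h1 h2 => rotation_symm_of_ge hu hpu hpq hq1 t h1 h2
        have hhigh : ∀ t : Set.Ico (0 : ℝ) 1, q ≤ (t : ℝ) → ρ.symm t = t :=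
          fun t h1 => rotation_symm_of_notMem hu hpu hpq hq1 t (Or.inr h1)
        have hq_iff : (t : ℝ) < q ↔ (t' : ℝ) < q := by
          rcases hqB with h | h
          · have := htt q (Finset.mem_union_right _ (Finset.mem_filter.2 ⟨h, hpq⟩))
            rw [← not_le, ← not_le, this]
          · rw [h]; exact iff_of_true t.2.2 t'.2.2
        rcases lt_or_ge (t : ℝ) q with htq | htq
        · have htq' := hq_iff.1 htq
          have e1 := hlow t ht htq
          have e2 := hlow t' ht' htq'
          have := hdisp (ρ.symm t) (ρ.symm t') (by rw [e1]; linarith) (by rw [e2]; linarith)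
            fun b hb => by
              rw [e1, e2, le_sub_iff_add_le, le_sub_iff_add_le]
              rcases lt_or_ge b p with hbp | hbp
              · exact htt _ (Finset.mem_union_left _ (Finset.mem_image_of_mem (· + (q - (p : ℝ)))
                  (Finset.mem_filter.2 ⟨hb, hbp⟩)))
              · constructor <;> intro <;> linarith
          linarith
        · have htq' : q ≤ (t' : ℝ) := not_lt.1 fun h => htq.not_gt (hq_iff.2 h)
          rw [hhigh t htq, hhigh t' htq']
          refine hdisp t t' (by linarith) (by linarith) fun b hb => ?_
          rcases le_or_gt b p with hbp | hbp
          · exact iff_of_true (by linarith) (by linarith)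
          · exact htt b (Finset.mem_union_right _ (Finset.mem_filter.2 ⟨hb, hbp⟩))

/-- Interval exchange transformations are products of restricted rotations. -/
theorem IsPiecewiseTranslation.mem_closure {s : Equiv.Perm (Set.Ico (0 : ℝ) 1)}
    (h : IsPiecewiseTranslation s) : s ∈ Subgroup.closure {s | IsRestrictedRotation s} := by
  obtain ⟨B, hB⟩ := h
  exact mem_closure_of_eqOn_Iio _ B 0 s le_rfl le_rfl
    (fun t ht => absurd t.2.1 ht.not_ge) fun t t' _ _ h => hB t t' h

/-! ### Exchanges of several layers of the cube -/

/-- Disjoint copies of the `n`-dimensional unit cube, the layers, indexed by `Λ`. -/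
abbrev Layered (n : ℕ) (Λ : Type) : Type := (Fin n → Set.Ico (0 : ℝ) 1) × Λ

section Layered

variable {n : ℕ} {Λ : Type}

/-- The two points are in the same layer and in the same cell of the grid that consists of the
hyperplanes on which some coordinate takes a value in `B`. -/
def SameCell (B : Finset ℝ) (ω ω' : Layered n Λ) : Prop :=
  ω.2 = ω'.2 ∧ ∀ i, ∀ b ∈ B, b ≤ (ω.1 i : ℝ) ↔ b ≤ (ω'.1 i : ℝ)

/-- The map `f` moves both points by the same vector and to the same layer. -/
def SameDisp (f : Equiv.Perm (Layered n Λ)) (ω ω' : Layered n Λ) : Prop :=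
  (f ω).2 = (f ω').2 ∧ ∀ i, ((f ω).1 i : ℝ) - ω.1 i = (f ω').1 i - ω'.1 i

/-- A rectangle exchange of several layers of the cube. Pieces may go from one layer to another.
Instead of a partition into rectangles, it is required that `f` is a translation on each cell of
some finite grid. -/
def IsExchange (f : Equiv.Perm (Layered n Λ)) : Prop :=
  ∃ B : Finset ℝ, ∀ ω ω', SameCell B ω ω' → SameDisp f ω ω'

theorem SameCell.mono {B B' : Finset ℝ} (h : B ⊆ B') {ω ω' : Layered n Λ}
    (hω : SameCell B' ω ω') : SameCell B ω ω' :=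
  ⟨hω.1, fun i b hb => hω.2 i b (h hb)⟩

theorem finite_range_of_sameCell [Finite Λ] {β : Type*} {F : Layered n Λ → β} {B : Finset ℝ}
    (h : ∀ ω ω', SameCell B ω ω' → F ω = F ω') : (Set.range F).Finite := by
  classical
  refine finite_range_of_factors
    (fun ω : Layered n Λ => (ω.2, fun i => B.filter (· ≤ (ω.1 i : ℝ)))) ?_ ?_
  · refine (Set.finite_univ.prod (Set.Finite.pi' fun _ : Fin n =>
      B.powerset.finite_toSet)).subset ?_
    rintro _ ⟨ω, rfl⟩
    exact ⟨trivial, fun i => Finset.mem_coe.2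
      (Finset.mem_powerset.2 (Finset.filter_subset _ _))⟩
  · intro ω ω' hω
    obtain ⟨h1, h2⟩ := Prod.mk.inj hω
    refine h ω ω' ⟨h1, fun i b hb => ?_⟩
    have := Finset.ext_iff.1 (congrFun h2 i) b
    simpa [hb] using this

theorem IsExchange.exists_finset_disp [Finite Λ] {f : Equiv.Perm (Layered n Λ)}
    (hf : IsExchange f) : ∃ V : Finset ℝ, ∀ ω i, ((f ω).1 i : ℝ) - ω.1 i ∈ V := by
  obtain ⟨B, hB⟩ := hf
  have h : ∀ i, (Set.range fun ω => ((f ω).1 i : ℝ) - ω.1 i).Finite := fun i =>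
    finite_range_of_sameCell (B := B) fun ω ω' hω => (hB ω ω' hω).2 i
  refine ⟨(Set.finite_iUnion h).toFinset, fun ω i => ?_⟩
  rw [Set.Finite.mem_toFinset]
  exact Set.mem_iUnion.2 ⟨i, ω, rfl⟩

theorem IsExchange.mul [Finite Λ] {f g : Equiv.Perm (Layered n Λ)} (hf : IsExchange f)
    (hg : IsExchange g) : IsExchange (f * g) := by
  classical
  obtain ⟨V, hV⟩ := hg.exists_finset_disp
  obtain ⟨B, hB⟩ := hf
  obtain ⟨C, hC⟩ := hg
  refine ⟨C ∪ Finset.image₂ (fun b v => b - v) B V, fun ω ω' hω => ?_⟩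
  have h1 := hC ω ω' (hω.mono Finset.subset_union_left)
  have h2 : SameCell B (g ω) (g ω') := by
    refine ⟨h1.1, fun i b hb => ?_⟩
    have h3 := hω.2 i _ (Finset.mem_union_right _ (Finset.mem_image₂_of_mem hb (hV ω i)))
    have h4 := h1.2 i
    constructor
    · intro h
      have := h3.1 (by linarith)
      linarith
    · intro h
      have := h3.2 (by linarith)
      linarith
  have h3 := hB _ _ h2
  refine ⟨h3.1, fun i => ?_⟩
  have h4 := h1.2 i
  have h5 := h3.2 i
  simp only [Equiv.Perm.mul_apply]
  linarith

theorem IsExchange.inv [Finite Λ] {f : Equiv.Perm (Layered n Λ)} (hf : IsExchange f) :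
    IsExchange f⁻¹ := by
  classical
  obtain ⟨V, hV⟩ := hf.exists_finset_disp
  obtain ⟨B, hB⟩ := hf
  refine ⟨Finset.image₂ (· + ·) (insert 0 (insert 1 B)) V, fun ω ω' hω => ?_⟩
  set α := f⁻¹ ω with hα
  have hfα : f α = ω := f.apply_symm_apply ω
  have hcell : ∀ b ∈ insert 0 (insert 1 B), ∀ i,
      b ≤ (α.1 i : ℝ) ↔ b ≤ (ω'.1 i : ℝ) - (ω.1 i - α.1 i) := by
    intro b hb i
    have h := hω.2 i _ (Finset.mem_image₂_of_mem hb (hV α i))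
    rw [hfα] at h
    constructor
    · intro h'
      have := h.1 (by linarith)
      linarith
    · intro h'
      have := h.2 (by linarith)
      linarith
  -- The grid contains the faces of the cube, so that this is a point of the cube.
  set α' : Layered n Λ := (fun i => ⟨(ω'.1 i : ℝ) - (ω.1 i - α.1 i),
    (hcell 0 (by simp) i).1 (α.1 i).2.1,
    not_le.1 fun h => (α.1 i).2.2.not_ge ((hcell 1 (by simp) i).2 h)⟩, α.2) with hα'
  have h1 := hB α α' ⟨rfl, fun i b hb => hcell b (by simp [hb]) i⟩
  have h2 : f α' = ω' := by
    refine Prod.ext ?_ ?_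
    · funext i
      have := h1.2 i
      rw [hfα] at this
      apply Subtype.ext
      simp only [hα'] at *
      linarith
    · rw [← h1.1, hfα, hω.1]
  have h3 : f⁻¹ ω' = α' := by rw [← h2]; exact f.symm_apply_apply α'
  refine ⟨by rw [h3], fun i => ?_⟩
  rw [h3, ← hα]
  simp only [hα']
  ring

/-- The exchanges that change only the `i`-th coordinate. -/
def axisExchanges (n : ℕ) (Λ : Type) (i : Fin n) : Set (Equiv.Perm (Layered n Λ)) :=
  {f | IsExchange f ∧ ∀ ω, (f ω).2 = ω.2 ∧ ∀ j, j ≠ i → (f ω).1 j = ω.1 j}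

open Classical in
/-- The exchanges that swap two layers, of the same type, above some part of the cube. -/
def layerExchanges (n : ℕ) {Λ A : Type} (ty : Λ → A) : Set (Equiv.Perm (Layered n Λ)) :=
  {f | IsExchange f ∧ ∃ l m, ty l = ty m ∧
    ∀ ω, (f ω).1 = ω.1 ∧ ((f ω).2 = ω.2 ∨ (f ω).2 = Equiv.swap l m ω.2)}

/-- The subgroup generated by exchanges along the axes and by exchanges of two layers of the
same type. -/
def axisLayerSubgroup (n : ℕ) {Λ A : Type} (ty : Λ → A) : Subgroup (Equiv.Perm (Layered n Λ)) :=
  Subgroup.closure ((⋃ i, axisExchanges n Λ i) ∪ layerExchanges n ty)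

theorem mem_axisLayerSubgroup_of_axis {A : Type} (ty : Λ → A) {f : Equiv.Perm (Layered n Λ)}
    (i : Fin n) (hf : f ∈ axisExchanges n Λ i) : f ∈ axisLayerSubgroup n ty :=
  Subgroup.subset_closure (Or.inl (Set.mem_iUnion.2 ⟨i, hf⟩))

theorem mem_axisLayerSubgroup_of_layer {A : Type} {ty : Λ → A} {f : Equiv.Perm (Layered n Λ)}
    (hf : f ∈ layerExchanges n ty) : f ∈ axisLayerSubgroup n ty :=
  Subgroup.subset_closure (Or.inr hf)

theorem ty_eq_of_mem_layerExchanges {A : Type} {ty : Λ → A} {f : Equiv.Perm (Layered n Λ)}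
    (hf : f ∈ layerExchanges n ty) (ω : Layered n Λ) : ty (f ω).2 = ty ω.2 := by
  classical
  obtain ⟨-, l, m, hlm, h⟩ := hf
  rcases (h ω).2 with h | h
  · rw [h]
  · rw [h, Equiv.swap_apply_def]
    split_ifs with h1 h2
    · rw [h1, hlm]
    · rw [h2, hlm]
    · rfl

/-- Applies to the first coordinate of a point a permutation that may depend on the other
coordinates and on the layer. -/
def fiberPerm (σ : Layered n Λ → Equiv.Perm (Set.Ico (0 : ℝ) 1)) :
    Equiv.Perm (Layered (n + 1) Λ) where
  toFun ω := (Fin.cons (σ (Fin.tail ω.1, ω.2) (ω.1 0)) (Fin.tail ω.1), ω.2)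
  invFun ω := (Fin.cons ((σ (Fin.tail ω.1, ω.2)).symm (ω.1 0)) (Fin.tail ω.1), ω.2)
  left_inv ω := by simp
  right_inv ω := by simp

theorem fiberPerm_apply (σ : Layered n Λ → Equiv.Perm (Set.Ico (0 : ℝ) 1))
    (ω : Layered (n + 1) Λ) : fiberPerm σ ω =
      (Fin.cons (σ (Fin.tail ω.1, ω.2) (ω.1 0)) (Fin.tail ω.1), ω.2) := rfl

theorem SameCell.tail {B : Finset ℝ} {ω ω' : Layered (n + 1) Λ} (h : SameCell B ω ω') :
    SameCell B ((Fin.tail ω.1, ω.2) : Layered n Λ) (Fin.tail ω'.1, ω'.2) :=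
  ⟨h.1, fun i b hb => h.2 i.succ b hb⟩

theorem fiberPerm_mem_axisExchanges [Finite Λ] {σ : Layered n Λ → Equiv.Perm (Set.Ico (0 : ℝ) 1)}
    {B : Finset ℝ} (hB : ∀ w w', SameCell B w w' → σ w = σ w')
    (hσ : ∀ w, IsPiecewiseTranslation (σ w)) : fiberPerm σ ∈ axisExchanges (n + 1) Λ 0 := by
  classical
  refine ⟨?_, fun ω => ⟨rfl, fun j hj => ?_⟩⟩
  · have hfin := finite_range_of_sameCell hB
    have hσ' : ∀ s : Set.range σ, IsPiecewiseTranslation s.1 := by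
      rintro ⟨_, w, rfl⟩
      exact hσ w
    choose C hC using hσ'
    have := hfin.to_subtype
    have := Fintype.ofFinite (Set.range σ)
    refine ⟨B ∪ Finset.univ.biUnion C, fun ω ω' h => ⟨h.1, ?_⟩⟩
    have h1 := hB _ _ (h.mono Finset.subset_union_left).tail
    refine Fin.cases ?_ fun i => ?_
    · simp only [fiberPerm_apply, Fin.cons_zero, h1]
      refine hC ⟨_, _, rfl⟩ _ _ fun b hb => h.2 0 b ?_
      exact Finset.mem_union_right _ (Finset.mem_biUnion.2 ⟨_, Finset.mem_univ _, hb⟩)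
    · simp [fiberPerm_apply, Fin.tail]
  · obtain ⟨i, rfl⟩ := Fin.exists_succ_eq.2 hj
    simp [fiberPerm_apply, Fin.tail]

end Layered

/-! ### Intervals of a subdivision as additional layers -/

namespace IsSubdivision

variable {n : ℕ} {Λ D : Type} {pos len : D → ℝ}

theorem slot_eq_slot (h : IsSubdivision 0 1 pos len) {t t' : Set.Ico (0 : ℝ) 1}
    (ht : ∀ d, pos d ≤ t ↔ pos d ≤ t') : h.slot t = h.slot t' := by
  have h1 := (ht _).1 (h.pos_slot_le t)
  have h2 := (ht _).2 (h.pos_slot_le t')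
  have h3 := h.lt_pos_slot_add t
  have h4 := h.lt_pos_slot_add t'
  have h5 := h.len_pos (h.slot t)
  have h6 := h.len_pos (h.slot t')
  exact h.eq_of_mem (t := max (pos (h.slot t)) (pos (h.slot t'))) (le_max_left _ _)
    (max_lt (by linarith) (by linarith)) (le_max_right _ _) (max_lt (by linarith) (by linarith))

/-- Replaces the first coordinate of a point by the slot in which it lies, as part of the index of
the layer. -/
noncomputable def drop (h : IsSubdivision 0 1 pos len) (ω : Layered (n + 1) Λ) :
    Layered n (Λ × D) :=
  (Fin.tail ω.1, (ω.2, h.slot (ω.1 0)))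

/-- The position of the first coordinate of a point within its slot. -/
noncomputable def offset (h : IsSubdivision 0 1 pos len) (ω : Layered (n + 1) Λ) : ℝ :=
  ω.1 0 - pos (h.slot (ω.1 0))

theorem ext_drop (h : IsSubdivision 0 1 pos len) {ω ω' : Layered (n + 1) Λ}
    (h1 : h.drop ω = h.drop ω') (h2 : h.offset ω = h.offset ω') : ω = ω' := by
  simp only [drop, offset, Prod.mk.injEq] at h1 h2
  refine Prod.ext ?_ h1.2.1
  rw [← Fin.cons_self_tail ω.1, ← Fin.cons_self_tail ω'.1, h1.1]
  congr 1
  rw [h1.2.2] at h2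
  exact Subtype.ext (by linarith)

/-- The point at the left end of a slot. -/
def base (h : IsSubdivision 0 1 pos len) (ω : Layered n (Λ × D)) : Layered (n + 1) Λ :=
  (Fin.cons ⟨pos ω.2.2, h.le_pos _, by linarith [h.len_pos ω.2.2, h.add_le ω.2.2]⟩ ω.1, ω.2.1)

theorem slot_base (h : IsSubdivision 0 1 pos len) (ω : Layered n (Λ × D)) :
    h.slot ((h.base ω).1 0) = ω.2.2 :=
  h.slot_eq le_rfl (by simpa [base] using h.len_pos ω.2.2)

theorem drop_base (h : IsSubdivision 0 1 pos len) (ω : Layered n (Λ × D)) :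
    h.drop (h.base ω) = ω := by
  rw [drop, slot_base]
  simp [base]

theorem offset_base (h : IsSubdivision 0 1 pos len) (ω : Layered n (Λ × D)) :
    h.offset (h.base ω) = 0 := by
  rw [offset, slot_base]
  simp [base]

/-- The map induced by an exchange of slots that preserves their lengths. -/
noncomputable def liftFun (h : IsSubdivision 0 1 pos len) (F : Equiv.Perm (Layered n (Λ × D)))
    (hF : ∀ ω, len (F ω).2.2 = len ω.2.2) (ω : Layered (n + 1) Λ) : Layered (n + 1) Λ :=
  (Fin.cons (h.move (F (h.drop ω)).2.2 (ω.1 0) (hF _)) (F (h.drop ω)).1, (F (h.drop ω)).2.1)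

theorem drop_liftFun (h : IsSubdivision 0 1 pos len) (F : Equiv.Perm (Layered n (Λ × D)))
    (hF : ∀ ω, len (F ω).2.2 = len ω.2.2) (ω : Layered (n + 1) Λ) :
    h.drop (h.liftFun F hF ω) = F (h.drop ω) := by
  simp [drop, liftFun]

theorem offset_liftFun (h : IsSubdivision 0 1 pos len) (F : Equiv.Perm (Layered n (Λ × D)))
    (hF : ∀ ω, len (F ω).2.2 = len ω.2.2) (ω : Layered (n + 1) Λ) :
    h.offset (h.liftFun F hF ω) = h.offset ω := by
  have h1 : h.slot ((h.liftFun F hF ω).1 0) = (F (h.drop ω)).2.2 := h.slot_move _ _ (hF _)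
  have h2 : ((h.liftFun F hF ω).1 0 : ℝ) = pos (F (h.drop ω)).2.2 + h.offset ω := rfl
  rw [offset, h1, h2]
  ring

theorem len_inv {F : Equiv.Perm (Layered n (Λ × D))}
    (hF : ∀ ω, len (F ω).2.2 = len ω.2.2) (ω) : len (F⁻¹ ω).2.2 = len ω.2.2 := by
  have := hF (F⁻¹ ω)
  rw [show F (F⁻¹ ω) = ω from F.apply_symm_apply ω] at this
  exact this.symm

/-- The permutation induced by an exchange of slots that preserves their lengths. -/
noncomputable def lift (h : IsSubdivision 0 1 pos len) (F : Equiv.Perm (Layered n (Λ × D)))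
    (hF : ∀ ω, len (F ω).2.2 = len ω.2.2) : Equiv.Perm (Layered (n + 1) Λ) where
  toFun := h.liftFun F hF
  invFun := h.liftFun F⁻¹ (len_inv hF)
  left_inv ω := h.ext_drop
    (by rw [drop_liftFun, drop_liftFun]; exact F.symm_apply_apply _)
    (by rw [offset_liftFun, offset_liftFun])
  right_inv ω := h.ext_drop
    (by rw [drop_liftFun, drop_liftFun]; exact F.apply_symm_apply _)
    (by rw [offset_liftFun, offset_liftFun])

theorem drop_lift (h : IsSubdivision 0 1 pos len) {F : Equiv.Perm (Layered n (Λ × D))}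
    (hF : ∀ ω, len (F ω).2.2 = len ω.2.2) (ω : Layered (n + 1) Λ) :
    h.drop (h.lift F hF ω) = F (h.drop ω) := h.drop_liftFun F hF ω

theorem offset_lift (h : IsSubdivision 0 1 pos len) {F : Equiv.Perm (Layered n (Λ × D))}
    (hF : ∀ ω, len (F ω).2.2 = len ω.2.2) (ω : Layered (n + 1) Λ) :
    h.offset (h.lift F hF ω) = h.offset ω := h.offset_liftFun F hF ω

theorem coe_lift_apply_zero (h : IsSubdivision 0 1 pos len)
    {F : Equiv.Perm (Layered n (Λ × D))} (hF : ∀ ω, len (F ω).2.2 = len ω.2.2)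
    (ω : Layered (n + 1) Λ) :
    ((h.lift F hF ω).1 0 : ℝ) = pos (F (h.drop ω)).2.2 + (ω.1 0 - pos (h.slot (ω.1 0))) := rfl

theorem lift_mul (h : IsSubdivision 0 1 pos len) {F G : Equiv.Perm (Layered n (Λ × D))}
    (hF : ∀ ω, len (F ω).2.2 = len ω.2.2) (hG : ∀ ω, len (G ω).2.2 = len ω.2.2)
    (hFG : ∀ ω, len ((F * G) ω).2.2 = len ω.2.2) :
    h.lift (F * G) hFG = h.lift F hF * h.lift G hG :=
  Equiv.ext fun ω => h.ext_drop
    (by rw [Equiv.Perm.mul_apply, drop_lift, drop_lift, drop_lift]; rfl)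
    (by rw [Equiv.Perm.mul_apply, offset_lift, offset_lift, offset_lift])

theorem lift_inv (h : IsSubdivision 0 1 pos len) {F : Equiv.Perm (Layered n (Λ × D))}
    (hF : ∀ ω, len (F ω).2.2 = len ω.2.2) :
    h.lift F⁻¹ (len_inv hF) = (h.lift F hF)⁻¹ := rfl

theorem lift_one (h : IsSubdivision 0 1 pos len)
    (h1 : ∀ ω, len ((1 : Equiv.Perm (Layered n (Λ × D))) ω).2.2 = len ω.2.2) :
    h.lift 1 h1 = 1 :=
  Equiv.ext fun ω => h.ext_drop (by rw [drop_lift]; rfl) (by rw [offset_lift]; rfl)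

theorem isExchange_lift [Fintype D] (h : IsSubdivision 0 1 pos len)
    {F : Equiv.Perm (Layered n (Λ × D))} (hF : ∀ ω, len (F ω).2.2 = len ω.2.2)
    (hex : IsExchange F) : IsExchange (h.lift F hF) := by
  classical
  obtain ⟨B, hB⟩ := hex
  refine ⟨B ∪ Finset.univ.image pos, fun ω ω' hω => ?_⟩
  have hslot : h.slot (ω.1 0) = h.slot (ω'.1 0) :=
    h.slot_eq_slot fun d => hω.2 0 _ (Finset.mem_union_right _ (by simp))
  have h1 := hB (h.drop ω) (h.drop ω')
    ⟨by rw [drop, drop, hω.1, hslot], (hω.mono Finset.subset_union_left).tail.2⟩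
  refine ⟨congrArg Prod.fst h1.1, Fin.cases ?_ fun i => ?_⟩
  · rw [coe_lift_apply_zero, coe_lift_apply_zero, h1.1, hslot]
    ring
  · exact h1.2 i

/-- A permutation that maps slots to slots of the same length, by translations, is induced by an
exchange with one coordinate less. -/
theorem exists_lift_eq (h : IsSubdivision 0 1 pos len) {k : Equiv.Perm (Layered (n + 1) Λ)}
    (hk : IsExchange k) (hdrop : ∀ ω ω', h.drop ω = h.drop ω' → h.drop (k ω) = h.drop (k ω'))
    (hoff : ∀ ω, h.offset (k ω) = h.offset ω)
    (hlen : ∀ ω, len (h.slot ((k ω).1 0)) = len (h.slot (ω.1 0))) :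
    ∃ F : Equiv.Perm (Layered n (Λ × D)), IsExchange F ∧
      ∃ hF, h.lift F hF = k := by
  set F : Layered n (Λ × D) → Layered n (Λ × D) := fun ω => h.drop (k (h.base ω)) with hF
  have hFk : ∀ ω, F (h.drop ω) = h.drop (k ω) := fun ω => hdrop _ _ (h.drop_base _)
  have hbij : Function.Bijective F := by
    constructor
    · intro ω ω' hω
      have h1 := k.injective (h.ext_drop hω (by rw [hoff, hoff, offset_base, offset_base]))
      rw [← h.drop_base ω, h1, h.drop_base]
    · intro ω
      refine ⟨h.drop (k⁻¹ (h.base ω)), ?_⟩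
      rw [hFk, show k (k⁻¹ (h.base ω)) = h.base ω from k.apply_symm_apply _, h.drop_base]
  have hlenF : ∀ ω, len (Equiv.ofBijective F hbij ω).2.2 = len ω.2.2 := by
    intro ω
    rw [Equiv.ofBijective_apply]
    exact (hlen _).trans (by rw [slot_base])
  refine ⟨Equiv.ofBijective F hbij, ?_, hlenF, ?_⟩
  · obtain ⟨B, hB⟩ := hk
    refine ⟨B, fun ω ω' hω => ?_⟩
    have h1 := hB (h.base ω) (h.base ω') ⟨congrArg Prod.fst hω.1,
      Fin.cases (fun b _ => by simp [base, hω.1]) fun i b hb => by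
        simpa [base] using hω.2 i b hb⟩
    have h2 : (k (h.base ω)).1 0 = (k (h.base ω')).1 0 := by
      have := h1.2 0
      have h3 : (h.base ω).1 0 = (h.base ω').1 0 := by simp [base, hω.1]
      rw [h3] at this
      exact Subtype.ext (sub_left_inj.1 this)
    refine ⟨?_, fun i => ?_⟩
    · simp only [Equiv.ofBijective_apply, hF, drop, h1.1, h2]
    · have := h1.2 i.succ
      simpa [hF, drop, base, Fin.tail] using this
  · refine Equiv.ext fun ω => h.ext_drop ?_ ?_
    · rw [drop_lift, Equiv.ofBijective_apply, hFk]
    · rw [offset_lift, hoff]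

theorem lift_mem_axisExchanges [Fintype D] (h : IsSubdivision 0 1 pos len) {i : Fin n}
    {F : Equiv.Perm (Layered n (Λ × D))} (hF : ∀ ω, len (F ω).2.2 = len ω.2.2)
    (hi : F ∈ axisExchanges n (Λ × D) i) : h.lift F hF ∈ axisExchanges (n + 1) Λ i.succ := by
  refine ⟨h.isExchange_lift hF hi.1, fun ω => ⟨?_, Fin.cases (fun _ => ?_) fun j hj => ?_⟩⟩
  · exact congrArg Prod.fst (hi.2 (h.drop ω)).1
  · apply Subtype.ext
    rw [coe_lift_apply_zero, (hi.2 (h.drop ω)).1]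
    simp [drop]
  · exact (hi.2 (h.drop ω)).2 j fun h' => hj (by rw [h'])

/-- Swapping slots in the same position of two layers is a swap of layers. -/
theorem lift_mem_layerExchanges [Fintype D] (h : IsSubdivision 0 1 pos len) {A : Type}
    {ty : Λ → A} {F : Equiv.Perm (Layered n (Λ × D))} (hF : ∀ ω, len (F ω).2.2 = len ω.2.2)
    (hex : IsExchange F) {l m : Λ} (p : D) (hlm : ty l = ty m) [DecidableEq (Λ × D)]
    (hsw : ∀ ω, (F ω).1 = ω.1 ∧
      ((F ω).2 = ω.2 ∨ (F ω).2 = Equiv.swap (l, p) (m, p) ω.2)) :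
    h.lift F hF ∈ layerExchanges (n + 1) ty := by
  classical
  have hsnd : ∀ x : Λ × D, (Equiv.swap (l, p) (m, p) x).2 = x.2 ∧
      ((Equiv.swap (l, p) (m, p) x).1 = x.1 ∨
        (Equiv.swap (l, p) (m, p) x).1 = Equiv.swap l m x.1) := by
    intro x
    rw [Equiv.swap_apply_def]
    split_ifs with h1 h2
    · simp [h1]
    · simp [h2]
    · simp
  refine ⟨h.isExchange_lift hF hex, l, m, hlm, fun ω => ⟨?_, ?_⟩⟩
  · funext j
    refine Fin.cases ?_ (fun j => ?_) j
    · apply Subtype.ext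
      have : (F (h.drop ω)).2.2 = h.slot (ω.1 0) := by
        rcases (hsw (h.drop ω)).2 with h1 | h1
        · rw [h1]; rfl
        · rw [h1, (hsnd _).1]; rfl
      rw [coe_lift_apply_zero, this]
      ring
    · exact congrFun (hsw (h.drop ω)).1 j
  · change (F (h.drop ω)).2.1 = _ ∨ (F (h.drop ω)).2.1 = _
    rcases (hsw (h.drop ω)).2 with h1 | h1
    · rw [h1]; exact Or.inl rfl
    · rw [h1]; exact (hsnd _).2

/-- Swapping two slots of the same layer is an exchange along the first axis. -/
theorem lift_mem_axisExchanges_zero [Fintype D] (h : IsSubdivision 0 1 pos len)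
    {F : Equiv.Perm (Layered n (Λ × D))} (hF : ∀ ω, len (F ω).2.2 = len ω.2.2)
    (hex : IsExchange F) (l : Λ) (p q : D) [DecidableEq (Λ × D)]
    (hsw : ∀ ω, (F ω).1 = ω.1 ∧
      ((F ω).2 = ω.2 ∨ (F ω).2 = Equiv.swap (l, p) (l, q) ω.2)) :
    h.lift F hF ∈ axisExchanges (n + 1) Λ 0 := by
  have hfst : ∀ x : Λ × D, (Equiv.swap (l, p) (l, q) x).1 = x.1 := by
    intro x
    rw [Equiv.swap_apply_def]
    split_ifs with h1 h2
    · simp [h1]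
    · simp [h2]
    · rfl
  refine ⟨h.isExchange_lift hF hex, fun ω => ⟨?_, Fin.cases (fun h => absurd rfl h) fun j _ => ?_⟩⟩
  · change (F (h.drop ω)).2.1 = _
    rcases (hsw (h.drop ω)).2 with h1 | h1
    · rw [h1]; rfl
    · rw [h1, hfst]; rfl
  · exact congrFun (hsw (h.drop ω)).1 j

/-- Swapping two slots in different positions of different layers amounts to swapping them in the
same position, after conjugation by the swap of two slots in the same layer. -/
theorem lift_mem_of_mem_layerExchanges [Fintype D] (h : IsSubdivision 0 1 pos len)
    {A : Type} {ty : Λ → A} {F : Equiv.Perm (Layered n (Λ × D))}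
    (hF : ∀ ω, len (F ω).2.2 = len ω.2.2)
    (hl : F ∈ layerExchanges n fun x : Λ × D => (ty x.1, len x.2)) :
    h.lift F hF ∈ axisLayerSubgroup (n + 1) ty := by
  classical
  obtain ⟨hex, ⟨l, p⟩, ⟨m, q⟩, hty, hsw⟩ := hl
  simp only [Prod.mk.injEq] at hty
  by_cases hlm : l = m
  · subst hlm
    refine mem_axisLayerSubgroup_of_axis _ 0
      (h.lift_mem_axisExchanges_zero hF hex l p q fun ω => ?_)
    convert hsw ω
  -- `E` swaps the slots `p` and `q` of layer `l` everywhere.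
  set S := Equiv.swap (l, p) (l, q) with hS
  set E : Equiv.Perm (Layered n (Λ × D)) := (Equiv.refl _).prodCongr S with hE
  have hEapp : ∀ ω, E ω = (ω.1, S ω.2) := fun ω => rfl
  have hEE : E * E = 1 := by
    ext1 ω
    simp [hEapp, hS]
  have hElen : ∀ ω, len (E ω).2.2 = len ω.2.2 := by
    intro ω
    rw [hEapp, hS, Equiv.swap_apply_def]
    split_ifs with h1 h2
    · simp [h1, hty.2]
    · simp [h2, hty.2]
    · rfl
  have hEex : IsExchange E := ⟨∅, fun ω ω' hω => ⟨by simp [hEapp, hω.1], fun i => by simp [hEapp]⟩⟩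
  have hElift : h.lift E hElen ∈ axisLayerSubgroup (n + 1) ty :=
    mem_axisLayerSubgroup_of_axis _ 0 (h.lift_mem_axisExchanges_zero hElen hEex l p q
      fun ω => ⟨rfl, Or.inr rfl⟩)
  have hFE : F = E * (E * F * E) * E := by
    have : E * (E * F * E) * E = (E * E) * F * (E * E) := by group
    rw [this, hEE, one_mul, mul_one]
  have hlen' : ∀ ω, len ((E * F * E) ω).2.2 = len ω.2.2 := fun ω =>
    (hElen _).trans ((hF _).trans (hElen ω))
  have hex' : IsExchange (E * F * E) := by
    obtain ⟨B, hB⟩ := hex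
    refine ⟨B, fun ω ω' hω => ?_⟩
    have := hB (E ω) (E ω') ⟨by simp [hEapp, hω.1], hω.2⟩
    exact ⟨congrArg S this.1, this.2⟩
  have hconj : S * Equiv.swap (l, p) (m, q) * S = Equiv.swap (l, q) (m, q) := by
    have h1 : S (l, p) = (l, q) := Equiv.swap_apply_left _ _
    have h2 : S (m, q) = (m, q) := by
      refine Equiv.swap_apply_of_ne_of_ne ?_ ?_ <;>
      · intro h'
        exact hlm (congrArg Prod.fst h').symm
    have h3 := Equiv.swap_apply_apply S (l, p) (m, q)
    rw [h1, h2] at h3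
    rw [h3, hS, Equiv.swap_inv]
  have hlift' : h.lift (E * F * E) hlen' ∈ axisLayerSubgroup (n + 1) ty := by
    refine mem_axisLayerSubgroup_of_layer
      (h.lift_mem_layerExchanges hlen' hex' (l := l) (m := m) q hty.1 fun ω => ⟨?_, ?_⟩)
    · exact (hsw (E ω)).1
    · change S (F (E ω)).2 = _ ∨ S (F (E ω)).2 = _
      rcases (hsw (E ω)).2 with h1 | h1
      · left
        rw [h1, hEapp, hS]
        simp
      · right
        rw [h1, ← hconj, hEapp]
        simp only [Equiv.Perm.mul_apply]
        congr!
  have hfin : h.lift F hF = h.lift E hElen * h.lift (E * F * E) hlen' * h.lift E hElen := by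
    have h1 : ∀ ω, len ((E * (E * F * E)) ω).2.2 = len ω.2.2 :=
      fun ω => (hElen _).trans (hlen' ω)
    have h2 : ∀ ω, len ((E * (E * F * E) * E) ω).2.2 = len ω.2.2 :=
      fun ω => (h1 _).trans (hElen ω)
    rw [← h.lift_mul hElen hlen' h1, ← h.lift_mul h1 hElen h2]
    congr 1
  rw [hfin]
  exact mul_mem (mul_mem hElift hlift') hElift

theorem lift_mem_of_mem [Fintype D] (h : IsSubdivision 0 1 pos len)
    {A : Type} {ty : Λ → A} {F : Equiv.Perm (Layered n (Λ × D))}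
    (hF : F ∈ axisLayerSubgroup n fun x : Λ × D => (ty x.1, len x.2)) :
    ∃ hlen, h.lift F hlen ∈ axisLayerSubgroup (n + 1) ty := by
  induction hF using Subgroup.closure_induction with
  | mem F hF =>
    rcases hF with hF | hF
    · obtain ⟨i, hi⟩ := Set.mem_iUnion.1 hF
      exact ⟨fun ω => by rw [(hi.2 ω).1],
        mem_axisLayerSubgroup_of_axis _ i.succ (h.lift_mem_axisExchanges _ hi)⟩
    · exact ⟨fun ω => congrArg Prod.snd (ty_eq_of_mem_layerExchanges hF ω),
        h.lift_mem_of_mem_layerExchanges _ hF⟩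
  | one =>
    have h1 : ∀ ω, len ((1 : Equiv.Perm (Layered n (Λ × D))) ω).2.2 = len ω.2.2 := fun _ => rfl
    exact ⟨h1, by rw [h.lift_one h1]; exact one_mem _⟩
  | mul F G _ _ hF hG =>
    obtain ⟨h1, h2⟩ := hF
    obtain ⟨h3, h4⟩ := hG
    have h5 : ∀ ω, len ((F * G) ω).2.2 = len ω.2.2 := fun ω => (h1 _).trans (h3 ω)
    exact ⟨h5, by rw [h.lift_mul h1 h3 h5]; exact mul_mem h2 h4⟩
  | inv F _ hF =>
    obtain ⟨h1, h2⟩ := hF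
    exact ⟨_, by rw [h.lift_inv h1]; exact inv_mem h2⟩

end IsSubdivision
/-! ### Generation by exchanges along the axes -/

theorem mem_closure_swap_of_forall_ty_eq {α A : Type*} [Fintype α] [DecidableEq α]
    (ty : α → A) (n : ℕ) :
    ∀ f : Equiv.Perm α, f.support.card ≤ n → (∀ x, ty (f x) = ty x) →
      f ∈ Subgroup.closure {g | ∃ x y, ty x = ty y ∧ g = Equiv.swap x y} := by
  induction n with
  | zero =>
    intro f hf _
    rw [Nat.le_zero, Finset.card_eq_zero, Equiv.Perm.support_eq_empty_iff] at hf
    rw [hf]; exact one_mem _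
  | succ n ih =>
    intro f hf hty
    by_cases hf1 : f = 1
    · rw [hf1]; exact one_mem _
    obtain ⟨x, hx⟩ : ∃ x, f x ≠ x := by
      by_contra! h
      exact hf1 (Equiv.ext h)
    have h1 := Equiv.Perm.card_support_swap_mul hx
    have h2 : ∀ y, ty (Equiv.swap x (f x) y) = ty y := by
      intro y
      rw [Equiv.swap_apply_def]
      split_ifs with h1 h2
      · rw [h1, hty]
      · rw [h2, hty]
      · rfl
    have h3 := ih (Equiv.swap x (f x) * f) (by omega) fun y => (h2 _).trans (hty y)
    have h4 : Equiv.swap x (f x) ∈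
        Subgroup.closure {g | ∃ x y, ty x = ty y ∧ g = Equiv.swap x y} :=
      Subgroup.subset_closure ⟨x, f x, (hty x).symm, rfl⟩
    have h5 := mul_mem h4 h3
    rwa [← mul_assoc, Equiv.swap_mul_self, one_mul] at h5

/-- The induction starts with permutations of a finite set. -/
theorem mem_axisLayerSubgroup_zero {Λ A : Type} [Finite Λ] (ty : Λ → A)
    (f : Equiv.Perm (Layered 0 Λ)) (hty : ∀ ω, ty (f ω).2 = ty ω.2) :
    f ∈ axisLayerSubgroup 0 ty := by
  classical
  have := Fintype.ofFinite Λ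
  have h := mem_closure_swap_of_forall_ty_eq (fun ω : Layered 0 Λ => ty ω.2) _ f le_rfl hty
  refine (Subgroup.closure_le _).2 ?_ h
  rintro _ ⟨x, y, hxy, rfl⟩
  refine mem_axisLayerSubgroup_of_layer ⟨⟨∅, fun ω ω' hω => ?_⟩, x.2, y.2, hxy, fun ω =>
    ⟨Subsingleton.elim _ _, Or.inr ?_⟩⟩
  · rw [show ω = ω' from Prod.ext (Subsingleton.elim _ _) hω.1]
    exact ⟨rfl, fun _ => rfl⟩
  · have key : ∀ a b : Layered 0 Λ, a = b ↔ a.2 = b.2 := fun a b =>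
      ⟨fun h => by rw [h], fun h => Prod.ext (Subsingleton.elim _ _) h⟩
    rw [Equiv.swap_apply_def, Equiv.swap_apply_def]
    simp only [key]
    split_ifs <;> rfl

/-- After an exchange along the first axis, any exchange of layers of the `(n+1)`-dimensional cube
maps slots of a suitable subdivision of the first coordinate to slots of the same length. -/
theorem exists_fiberPerm_mul_eq_lift {n : ℕ} {Λ : Type} [Finite Λ]
    {f : Equiv.Perm (Layered (n + 1) Λ)} (hf : IsExchange f) :
    ∃ (D : Type) (_ : Fintype D) (pos len : D → ℝ) (h : IsSubdivision 0 1 pos len),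
      ∃ g ∈ axisExchanges (n + 1) Λ 0, ∃ F : Equiv.Perm (Layered n (Λ × D)), IsExchange F ∧
        ∃ hF, h.lift F hF = g * f := by
  obtain ⟨B, hB⟩ := hf
  obtain ⟨D, hDfin, pos, len, h, hind, hpos⟩ := exists_isSubdivision_linearIndepOn B
  have hf : IsExchange f := ⟨B, hB⟩
  obtain ⟨B', hB'⟩ := hf.inv
  -- The grid of `f` does not separate points of one slot.
  have hcell : ∀ (ω ω' : Layered (n + 1) Λ), h.drop ω = h.drop ω' → SameCell B ω ω' := by
    intro ω ω' hω
    simp only [IsSubdivision.drop, Prod.mk.injEq] at hω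
    refine ⟨hω.2.1, Fin.cases (fun b hb => ?_) fun i b _ => ?_⟩
    · rcases lt_or_ge b 0 with h0 | h0
      · exact iff_of_true (h0.le.trans (ω.1 0).2.1) (h0.le.trans (ω'.1 0).2.1)
      rcases lt_or_ge b 1 with h1 | h1
      · obtain ⟨d, rfl⟩ := hpos b hb h0 h1
        exact h.pos_le_iff_of_slot_eq hω.2.2 d
      · exact iff_of_false (fun h' => (ω.1 0).2.2.not_ge (h1.trans h'))
          fun h' => (ω'.1 0).2.2.not_ge (h1.trans h')
    · have := congrFun hω.1 i
      simp only [Fin.tail] at this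
      rw [this]
  -- `c w τ` is the first coordinate of the preimage of the point of the fibre over `w` at `τ`.
  set pt : Layered n Λ → Set.Ico (0 : ℝ) 1 → Layered (n + 1) Λ :=
    fun w τ => (Fin.cons τ w.1, w.2) with hpt
  set c : Layered n Λ → Set.Ico (0 : ℝ) 1 → Set.Ico (0 : ℝ) 1 :=
    fun w τ => (f⁻¹ (pt w τ)).1 0 with hc
  have hpt_eq : ∀ ω : Layered (n + 1) Λ, ω = pt (Fin.tail ω.1, ω.2) (ω.1 0) := by
    intro ω
    simp [hpt]
  have hff : ∀ ω, f (f⁻¹ ω) = ω := fun ω => f.apply_symm_apply ω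
  have hff' : ∀ ω, f⁻¹ (f ω) = ω := fun ω => f.symm_apply_apply ω
  -- `f` maps points of the same slot into the same fibre.
  have hmove : ∀ ω ω', h.drop ω = h.drop ω' → (f ω).2 = (f ω').2 ∧
      Fin.tail (f ω).1 = Fin.tail (f ω').1 ∧
      ((f ω').1 0 : ℝ) - (f ω).1 0 = ω'.1 0 - ω.1 0 := by
    intro ω ω' hω
    have h1 := hB _ _ (hcell ω ω' hω)
    refine ⟨h1.1, ?_, ?_⟩
    · funext i
      have h2 := h1.2 i.succ
      have h3 : ω.1 i.succ = ω'.1 i.succ := congrFun (congrArg Prod.fst hω) i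
      rw [h3] at h2
      exact Subtype.ext (sub_left_inj.1 h2)
    · have := h1.2 0
      linarith
  have hcpt : ∀ w, IsPiecewiseTranslation (c w) := fun w =>
    ⟨B', fun t t' ht => by
      have := (hB' (pt w t) (pt w t') ⟨rfl, Fin.cases ht fun i b _ => Iff.rfl⟩).2 0
      exact this⟩
  have hcoh : ∀ w, ∀ τ t', h.slot t' = h.slot (c w τ) →
      ∃ τ', c w τ' = t' ∧ (τ' : ℝ) - τ = t' - c w τ := by
    intro w τ t' ht'
    set ω := f⁻¹ (pt w τ) with hω
    set ω' : Layered (n + 1) Λ := (Fin.cons t' (Fin.tail ω.1), ω.2) with hω'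
    have h1 : h.drop ω = h.drop ω' := by
      simp only [IsSubdivision.drop, hω', Fin.tail_cons, Fin.cons_zero, ht']
      rfl
    obtain ⟨h2, h3, h4⟩ := hmove _ _ h1
    have hfω : f ω = pt w τ := hff _
    have h5 : f ω' = pt w ((f ω').1 0) := by
      conv_lhs => rw [hpt_eq (f ω'), ← h2, ← h3, hfω]
      simp [hpt]
    refine ⟨(f ω').1 0, ?_, ?_⟩
    · simp only [hc]
      rw [← h5, hff']
      simp [hω']
    · rw [hfω] at h4
      exact h4
  have hsort := fun w => h.exists_sorting hind (c w) (hcpt w) (hcoh w)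
  -- The sorting permutation is chosen as a function of `c w` alone, so that it depends on `w` only
  -- through the cell of `w`.
  have hsort' : ∀ a : Set.range c, ∃ s : Equiv.Perm (Set.Ico (0 : ℝ) 1),
      IsPiecewiseTranslation s ∧
      (∀ τ τ', h.slot (a.1 τ) = h.slot (a.1 τ') → (τ' : ℝ) - τ = a.1 τ' - a.1 τ →
        h.slot (s τ) = h.slot (s τ')) ∧
      ∀ τ, len (h.slot (s τ)) = len (h.slot (a.1 τ)) ∧
        (s τ : ℝ) - pos (h.slot (s τ)) = a.1 τ - pos (h.slot (a.1 τ)) := by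
    rintro ⟨_, w, rfl⟩
    exact hsort w
  choose S hS1 hS2 hS3 using hsort'
  set σ : Layered n Λ → Equiv.Perm (Set.Ico (0 : ℝ) 1) := fun w => S ⟨c w, w, rfl⟩ with hσ
  have hσcell : ∀ w w', SameCell B' w w' → σ w = σ w' := by
    intro w w' hw
    have : c w = c w' := by
      funext t
      have := (hB' (pt w t) (pt w' t) ⟨hw.1, Fin.cases (fun b _ => Iff.rfl) fun i b hb =>
        hw.2 i b hb⟩).2 0
      exact Subtype.ext (sub_left_inj.1 this)
    simp only [hσ, this]
  have hg := fiberPerm_mem_axisExchanges hσcell fun w => hS1 ⟨c w, w, rfl⟩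
  have hk0 : ∀ ω, ((fiberPerm σ * f) ω).1 0 =
      σ (Fin.tail (f ω).1, (f ω).2) ((f ω).1 0) := fun ω => rfl
  have hkc : ∀ ω, c (Fin.tail (f ω).1, (f ω).2) ((f ω).1 0) = ω.1 0 := by
    intro ω
    simp only [hc]
    rw [← hpt_eq, hff']
  refine ⟨D, hDfin, pos, len, h, fiberPerm σ, hg, h.exists_lift_eq (hg.1.mul hf) ?_ ?_ ?_⟩
  · intro ω ω' hω
    obtain ⟨h1, h2, h3⟩ := hmove _ _ hω
    have h4 := hkc ω
    have h5 := hkc ω'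
    have h6 : h.slot (((fiberPerm σ * f) ω).1 0) = h.slot (((fiberPerm σ * f) ω').1 0) := by
      rw [hk0, hk0, h1, h2]
      rw [h1, h2] at h4
      refine hS2 _ _ _ ?_ ?_
      · simp only
        rw [h4, h5]
        exact congrArg (fun x => x.2.2) hω
      · simp only
        rw [h4, h5, h3]
    have h7 : Fin.tail ((fiberPerm σ * f) ω).1 = Fin.tail ((fiberPerm σ * f) ω').1 := by
      simpa [fiberPerm_apply] using h2
    have h8 : ((fiberPerm σ * f) ω).2 = ((fiberPerm σ * f) ω').2 := h1
    simp only [IsSubdivision.drop, h6, h7, h8]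
  · intro ω
    simp only [IsSubdivision.offset]
    rw [hk0, (hS3 _ _).2]
    simp only
    rw [hkc]
  · intro ω
    rw [hk0, (hS3 _ _).1]
    simp only
    rw [hkc]

/-- By induction on the dimension: an exchange along the first axis turns `f` into an exchange of
slots of the first coordinate, which is an exchange of more layers in one dimension less. -/
theorem IsExchange.mem_axisLayerSubgroup (n : ℕ) : ∀ {Λ A : Type} [Finite Λ] (ty : Λ → A)
    {f : Equiv.Perm (Layered n Λ)}, IsExchange f → (∀ ω, ty (f ω).2 = ty ω.2) →
    f ∈ axisLayerSubgroup n ty := by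
  induction n with
  | zero => exact fun ty f _ hty => mem_axisLayerSubgroup_zero ty f hty
  | succ n ih =>
    intro Λ A _ ty f hf hty
    obtain ⟨D, _, pos, len, h, g, hg, F, hF, hlen, hlift⟩ := exists_fiberPerm_mul_eq_lift hf
    have hFty : ∀ ω, ty (F ω).2.1 = ty ω.2.1 := by
      intro ω
      have h1 := congrArg (fun k => h.drop (k (h.base ω))) hlift
      simp only [h.drop_lift, h.drop_base] at h1
      rw [h1]
      exact (congrArg ty (hg.2 _).1).trans (hty _)
    obtain ⟨_, h1⟩ := h.lift_mem_of_mem (ty := ty) (ih (fun x : Λ × D => (ty x.1, len x.2)) hF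
      fun ω => Prod.ext (hFty ω) (hlen ω))
    rw [hlift] at h1
    exact (Subgroup.mul_mem_cancel_left _ (mem_axisLayerSubgroup_of_axis ty 0 hg)).1 h1

/-! ### Rectangle exchanges and grids -/

section Grid

variable {ι : Type*}

/-- The permutation `f` of the unit cube is a translation on each cell of the grid that consists of
the hyperplanes on which some coordinate takes a value in some finite set `B`. -/
def IsGridTranslation (f : Equiv.Perm (unitCube ι)) : Prop :=
  ∃ B : Finset ℝ, ∀ x y : unitCube ι, (∀ i, ∀ b ∈ B, b ≤ x.1 i ↔ b ≤ y.1 i) →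
    ∀ i, (f x).1 i - x.1 i = (f y).1 i - y.1 i

/-- The cell that contains `x` of the grid with coordinates in `B`. -/
def gridCell (B : Finset ℝ) (x : ι → ℝ) : Set (ι → ℝ) :=
  {y | y ∈ unitCube ι ∧ ∀ i, ∀ b ∈ B, b ≤ x i ↔ b ≤ y i}

theorem mem_gridCell_self {B : Finset ℝ} {x : ι → ℝ} (hx : x ∈ unitCube ι) :
    x ∈ gridCell B x := ⟨hx, fun _ _ _ => Iff.rfl⟩

theorem gridCell_eq_of_mem {B : Finset ℝ} {x y : ι → ℝ} (h : y ∈ gridCell B x) :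
    gridCell B y = gridCell B x := by
  ext z
  exact and_congr_right fun _ => forall₃_congr fun i b hb => by rw [h.2 i b hb]

/-- The last element of `B` up to `p`, or `0`. -/
theorem exists_prev (B : Finset ℝ) (p : ℝ) (hp : 0 ≤ p) :
    ∃ q, q ≤ p ∧ 0 ≤ q ∧ (q ∈ B ∨ q = 0) ∧ ∀ b ∈ B, b ≤ p → b ≤ q := by
  classical
  set S := insert 0 (B.filter (· ≤ p)) with hS
  have hne : S.Nonempty := ⟨0, Finset.mem_insert_self _ _⟩
  have hmax := Finset.max'_mem S hne
  refine ⟨S.max' hne, ?_, S.le_max' 0 (Finset.mem_insert_self _ _), ?_, ?_⟩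
  · rcases Finset.mem_insert.1 hmax with h | h
    · rw [h]; exact hp
    · exact (Finset.mem_filter.1 h).2
  · rcases Finset.mem_insert.1 hmax with h | h
    · exact Or.inr h
    · exact Or.inl (Finset.mem_filter.1 h).1
  · intro b hb h1
    exact S.le_max' b (Finset.mem_insert_of_mem (Finset.mem_filter.2 ⟨hb, h1⟩))

theorem isRectangle_gridCell (B : Finset ℝ) {x : ι → ℝ} (hx : x ∈ unitCube ι) :
    IsRectangle (gridCell B x) := by
  choose u hux hu0 huB hu using fun i => exists_prev B (x i) (hx i).1
  choose v hxv hv1 hvB hv using fun i => exists_next B (x i) (hx i).2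
  refine ⟨u, v, fun i => ⟨hu0 i, (hux i).trans_lt (hxv i), hv1 i⟩, ?_⟩
  ext y
  constructor
  · rintro ⟨hy, h⟩ i
    constructor
    · rcases huB i with h1 | h1
      · exact (h i _ h1).1 (hux i)
      · rw [h1]; exact (hy i).1
    · rcases hvB i with h1 | h1
      · exact not_le.1 fun h2 => (hxv i).not_ge ((h i _ h1).2 h2)
      · rw [h1]; exact (hy i).2
  · intro h
    refine ⟨fun i => ⟨(hu0 i).trans (h i).1, (h i).2.trans_le (hv1 i)⟩, fun i b hb => ?_⟩
    constructor
    · intro h1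
      exact (hu i b hb h1).trans (h i).1
    · intro h1
      by_contra! h2
      have := hv i b hb h2 (h1.trans_lt ((h i).2.trans_le (hv1 i)))
      exact (h i).2.not_ge (this.trans h1)

theorem finite_range_gridCell [Finite ι] (B : Finset ℝ) :
    (Set.range fun x : unitCube ι => gridCell B (x : ι → ℝ)).Finite := by
  classical
  refine finite_range_of_factors (fun x : unitCube ι => fun i => B.filter (· ≤ x.1 i)) ?_ ?_
  · refine (Set.Finite.pi' fun _ : ι => B.powerset.finite_toSet).subset ?_
    rintro _ ⟨x, rfl⟩ i
    exact Finset.mem_coe.2 (Finset.mem_powerset.2 (Finset.filter_subset _ _))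
  · intro x y hxy
    refine gridCell_eq_of_mem (B := B) ⟨x.2, fun i b hb => ?_⟩
    have := Finset.ext_iff.1 (congrFun hxy i) b
    simpa [hb] using this.symm

theorem IsGridTranslation.isRectangleExchange [Finite ι] {f : Equiv.Perm (unitCube ι)}
    (hf : IsGridTranslation f) : IsRectangleExchange f := by
  obtain ⟨B, hB⟩ := hf
  refine ⟨Set.range fun x : unitCube ι => gridCell B (x : ι → ℝ),
    ⟨finite_range_gridCell B, ?_, ?_, ?_⟩, ?_⟩
  · rintro _ ⟨x, rfl⟩
    exact isRectangle_gridCell B x.2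
  · rintro _ ⟨x, rfl⟩ _ ⟨y, rfl⟩ hne
    rw [Set.disjoint_left]
    intro z hzx hzy
    exact hne ((gridCell_eq_of_mem hzx).symm.trans (gridCell_eq_of_mem hzy))
  · ext x
    constructor
    · rintro ⟨_, ⟨y, rfl⟩, hx⟩
      exact hx.1
    · intro hx
      exact ⟨_, ⟨⟨x, hx⟩, rfl⟩, mem_gridCell_self hx⟩
  · rintro _ ⟨x, rfl⟩
    refine ⟨(f x : ι → ℝ) - x, fun y hy => ?_⟩
    funext i
    have := hB x y hy.2 i
    simp only [Pi.add_apply, Pi.sub_apply]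
    linarith

theorem IsRectangleExchange.isGridTranslation [Finite ι] {f : Equiv.Perm (unitCube ι)}
    (hf : IsRectangleExchange f) : IsGridTranslation f := by
  classical
  have := Fintype.ofFinite ι
  obtain ⟨P, hP, hfP⟩ := hf
  have h := hP.isRectangle
  choose! a b _ hK using h
  refine ⟨hP.finite.toFinset.biUnion fun K => Finset.univ.image (a K) ∪ Finset.univ.image (b K),
    fun x y hxy i => ?_⟩
  obtain ⟨K, hKP, hxK⟩ := hP.exists_mem x
  have hyK : (y : ι → ℝ) ∈ K := by
    rw [hK K hKP] at hxK ⊢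
    intro j
    have h1 := hxy j (a K j) (Finset.mem_biUnion.2 ⟨K, by simpa using hKP, by simp⟩)
    have h2 := hxy j (b K j) (Finset.mem_biUnion.2 ⟨K, by simpa using hKP, by simp⟩)
    exact ⟨h1.1 (hxK j).1, not_le.1 fun h3 => (hxK j).2.not_ge (h2.2 h3)⟩
  obtain ⟨v, hv⟩ := hfP K hKP
  rw [hv x hxK, hv y hyK]
  simp

end Grid

/-! ### Shuffles -/

section Shuffle

theorem prPerp_eq_iff {ι : Type*} {i : ι} {x y : ι → ℝ} :
    prPerp i x = prPerp i y ↔ ∀ j, j ≠ i → x j = y j :=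
  ⟨fun h j hj => congrFun h ⟨j, hj⟩, fun h => funext fun j => h j j.2⟩

variable {ι : Type*} [DecidableEq ι]

theorem shuffle_apply_of_notMem {i : ι} {R : Set ({j : ι // j ≠ i} → ℝ)}
    (s : Equiv.Perm (Set.Ico (0 : ℝ) 1)) {x : unitCube ι} (hx : prPerp i (x : ι → ℝ) ∉ R) :
    shuffle i R s x = x := by
  simp [shuffle, shuffleMap, hx]

theorem shuffle_apply_self {i : ι} {R : Set ({j : ι // j ≠ i} → ℝ)}
    (s : Equiv.Perm (Set.Ico (0 : ℝ) 1)) {x : unitCube ι} (hx : prPerp i (x : ι → ℝ) ∈ R) :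
    (shuffle i R s x : ι → ℝ) i = s ⟨x.1 i, x.2 i⟩ := by
  simp [shuffle, shuffleMap, hx]

theorem shuffle_apply_of_ne {i : ι} (R : Set ({j : ι // j ≠ i} → ℝ))
    (s : Equiv.Perm (Set.Ico (0 : ℝ) 1)) (x : unitCube ι) {j : ι} (hj : j ≠ i) :
    (shuffle i R s x : ι → ℝ) j = x.1 j := by
  by_cases hx : prPerp i (x : ι → ℝ) ∈ R
  · simp [shuffle, shuffleMap, hx, hj]
  · rw [shuffle_apply_of_notMem s hx]

theorem prPerp_shuffle (i : ι) (R : Set ({j : ι // j ≠ i} → ℝ))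
    (s : Equiv.Perm (Set.Ico (0 : ℝ) 1)) (x : unitCube ι) :
    prPerp i (shuffle i R s x : ι → ℝ) = prPerp i (x : ι → ℝ) :=
  prPerp_eq_iff.2 fun _ hj => shuffle_apply_of_ne R s x hj

theorem shuffle_mul (i : ι) (R : Set ({j : ι // j ≠ i} → ℝ))
    (s s' : Equiv.Perm (Set.Ico (0 : ℝ) 1)) :
    shuffle i R (s * s') = shuffle i R s * shuffle i R s' := by
  ext x j
  rw [Equiv.Perm.mul_apply]
  by_cases hj : j = i
  · subst hj
    by_cases hx : prPerp j (x : ι → ℝ) ∈ R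
    · rw [shuffle_apply_self _ hx, shuffle_apply_self _ (by rwa [prPerp_shuffle])]
      simp only [shuffle_apply_self _ hx]
      rfl
    · rw [shuffle_apply_of_notMem _ hx, shuffle_apply_of_notMem _ hx,
        shuffle_apply_of_notMem _ hx]
  · rw [shuffle_apply_of_ne _ _ _ hj, shuffle_apply_of_ne _ _ _ hj,
      shuffle_apply_of_ne _ _ _ hj]

/-- Shuffles in direction `i` over the set `R`, as a homomorphism. -/
noncomputable def shuffleHom (i : ι) (R : Set ({j : ι // j ≠ i} → ℝ)) :
    Equiv.Perm (Set.Ico (0 : ℝ) 1) →* Equiv.Perm (unitCube ι) :=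
  MonoidHom.mk' (shuffle i R) (shuffle_mul i R)

theorem isGridTranslation_shuffle [Finite ι] {i : ι} {R : Set ({j : ι // j ≠ i} → ℝ)}
    {s : Equiv.Perm (Set.Ico (0 : ℝ) 1)} (hR : IsRectangle R) (hs : IsRestrictedRotation s) :
    IsGridTranslation (shuffle i R s) := by
  classical
  have := Fintype.ofFinite ι
  obtain ⟨u, v, -, rfl⟩ := hR
  obtain ⟨a, b, c, -, hab, hbc, -, hs⟩ := hs
  refine ⟨{a, b, c} ∪ (Finset.univ.image u ∪ Finset.univ.image v), fun x y hxy j => ?_⟩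
  have hmem : ∀ x y : unitCube ι, (∀ i, ∀ t ∈ {a, b, c} ∪
      (Finset.univ.image u ∪ Finset.univ.image v), t ≤ x.1 i ↔ t ≤ y.1 i) →
      prPerp i (x : ι → ℝ) ∈ {x | ∀ i, x i ∈ Set.Ico (u i) (v i)} →
      prPerp i (y : ι → ℝ) ∈ {x | ∀ i, x i ∈ Set.Ico (u i) (v i)} := by
    intro x y hxy hx k
    have h1 := hxy k (u k) (by simp)
    have h2 := hxy k (v k) (by simp)
    exact ⟨h1.1 (hx k).1, not_le.1 fun h3 => (hx k).2.not_ge (h2.2 h3)⟩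
  by_cases hj : j = i
  · subst hj
    by_cases hx : prPerp j (x : ι → ℝ) ∈ {x | ∀ i, x i ∈ Set.Ico (u i) (v i)}
    · have hy := hmem x y hxy hx
      rw [shuffle_apply_self _ hx, shuffle_apply_self _ hy]
      have ha := hxy j a (by simp)
      have hb := hxy j b (by simp)
      have hc := hxy j c (by simp)
      obtain ⟨h1, h2, h3⟩ := hs ⟨x.1 j, x.2 j⟩
      obtain ⟨h1', h2', h3'⟩ := hs ⟨y.1 j, y.2 j⟩
      simp only [Set.mem_Ico] at *
      by_cases hxa : a ≤ x.1 j
      · by_cases hxb : b ≤ x.1 j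
        · by_cases hxc : c ≤ x.1 j
          · rw [h3 (fun h => h.2.not_ge hxc), h3' (fun h => h.2.not_ge (hc.1 hxc))]
            simp
          · rw [h2 ⟨hxb, not_le.1 hxc⟩, h2' ⟨hb.1 hxb, not_le.1 fun h => hxc (hc.2 h)⟩]
            ring
        · rw [h1 ⟨hxa, not_le.1 hxb⟩, h1' ⟨ha.1 hxa, not_le.1 fun h => hxb (hb.2 h)⟩]
          ring
      · rw [h3 (fun h => hxa h.1), h3' (fun h => hxa (ha.2 h.1))]
        simp
    · have hy : prPerp j (y : ι → ℝ) ∉ {x | ∀ i, x i ∈ Set.Ico (u i) (v i)} :=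
        fun hy => hx (hmem y x (fun i t ht => (hxy i t ht).symm) hy)
      rw [shuffle_apply_of_notMem _ hx, shuffle_apply_of_notMem _ hy]
      simp
  · rw [shuffle_apply_of_ne _ _ _ hj, shuffle_apply_of_ne _ _ _ hj]
    simp

/-- The point `x` with its `i`-th coordinate replaced by `t`. -/
def updateCoord (i : ι) (x : unitCube ι) (t : Set.Ico (0 : ℝ) 1) : unitCube ι :=
  ⟨Function.update (x : ι → ℝ) i t, fun j => by
    by_cases hj : j = i
    · subst hj
      rw [Function.update_self]
      exact t.2
    · rw [Function.update_of_ne hj]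
      exact x.2 j⟩

theorem updateCoord_self (i : ι) (x : unitCube ι) (t : Set.Ico (0 : ℝ) 1) :
    (updateCoord i x t).1 i = t := Function.update_self _ _ _

theorem updateCoord_of_ne {i j : ι} (hj : j ≠ i) (x : unitCube ι) (t : Set.Ico (0 : ℝ) 1) :
    (updateCoord i x t).1 j = x.1 j := Function.update_of_ne hj _ _

/-- A permutation that changes only the `i`-th coordinate induces a permutation of each line in
this direction. -/
def linePerm (i : ι) (f : Equiv.Perm (unitCube ι)) (hf : ∀ x j, j ≠ i → (f x).1 j = x.1 j)
    (x : unitCube ι) : Equiv.Perm (Set.Ico (0 : ℝ) 1) where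
  toFun t := ⟨(f (updateCoord i x t)).1 i, (f (updateCoord i x t)).2 i⟩
  invFun t := ⟨(f.symm (updateCoord i x t)).1 i, (f.symm (updateCoord i x t)).2 i⟩
  left_inv t := by
    have : updateCoord i x ⟨(f (updateCoord i x t)).1 i, (f (updateCoord i x t)).2 i⟩ =
        f (updateCoord i x t) := by
      refine Subtype.ext (funext fun j => ?_)
      by_cases hj : j = i
      · subst hj; rw [updateCoord_self]
      · rw [updateCoord_of_ne hj, hf _ j hj, updateCoord_of_ne hj]
    apply Subtype.ext
    simp only
    rw [this, Equiv.symm_apply_apply, updateCoord_self]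
  right_inv t := by
    have : updateCoord i x ⟨(f.symm (updateCoord i x t)).1 i,
        (f.symm (updateCoord i x t)).2 i⟩ = f.symm (updateCoord i x t) := by
      refine Subtype.ext (funext fun j => ?_)
      by_cases hj : j = i
      · subst hj; rw [updateCoord_self]
      · have := hf (f.symm (updateCoord i x t)) j hj
        rw [Equiv.apply_symm_apply] at this
        rw [updateCoord_of_ne hj, ← this, updateCoord_of_ne hj]
    apply Subtype.ext
    simp only
    rw [this, Equiv.apply_symm_apply, updateCoord_self]

end Shuffle

theorem shuffle_mem_closure {d : ℕ} {i : Fin d} {R : Set ({j : Fin d // j ≠ i} → ℝ)}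
    (hR : IsRectangle R) {s : Equiv.Perm (Set.Ico (0 : ℝ) 1)} (hs : IsPiecewiseTranslation s) :
    shuffle i R s ∈ Subgroup.closure (restrictedShuffles d) := by
  have h : Subgroup.closure {s | IsRestrictedRotation s} ≤
      (Subgroup.closure (restrictedShuffles d)).comap (shuffleHom i R) :=
    (Subgroup.closure_le _).2 fun s hs => Subgroup.subset_closure ⟨i, R, s, hR, hs, rfl⟩
  exact h hs.mem_closure

/-- A rectangle exchange that changes only one coordinate is, over each of finitely many cells of
the orthogonal hyperplane, an interval exchange of that coordinate. -/
theorem mem_closure_restrictedShuffles_of_axis {d : ℕ} {i : Fin d}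
    {f : Equiv.Perm (unitCube (Fin d))} (hgrid : IsGridTranslation f)
    (hf : ∀ x j, j ≠ i → (f x).1 j = x.1 j) :
    f ∈ Subgroup.closure (restrictedShuffles d) := by
  classical
  obtain ⟨B, hB⟩ := hgrid
  have hpr : ∀ x : unitCube (Fin d), prPerp i (x : Fin d → ℝ) ∈ unitCube {j // j ≠ i} :=
    fun x j => x.2 j
  set cell : unitCube (Fin d) → Set ({j : Fin d // j ≠ i} → ℝ) :=
    fun x => gridCell B (prPerp i (x : Fin d → ℝ)) with hcell
  have hprf : ∀ x, prPerp i (f x : Fin d → ℝ) = prPerp i (x : Fin d → ℝ) :=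
    fun x => prPerp_eq_iff.2 (hf x)
  have hfin : (Set.range cell).Finite := by
    refine (finite_range_gridCell (ι := {j : Fin d // j ≠ i}) B).subset ?_
    rintro _ ⟨x, rfl⟩
    exact ⟨⟨_, hpr x⟩, rfl⟩
  have hline : ∀ x, IsPiecewiseTranslation (linePerm i f hf x) := by
    refine fun x => ⟨B, fun t t' ht => ?_⟩
    have := hB (updateCoord i x t) (updateCoord i x t') (fun j b hb => ?_) i
    · rw [updateCoord_self, updateCoord_self] at this
      exact this
    · by_cases hj : j = i
      · subst hj
        rw [updateCoord_self, updateCoord_self]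
        exact ht b hb
      · rw [updateCoord_of_ne hj, updateCoord_of_ne hj]
  have hfx : ∀ x y : unitCube (Fin d), prPerp i (y : Fin d → ℝ) ∈ cell x →
      shuffle i (cell x) (linePerm i f hf x) y = f y := by
    intro x y hy
    refine Subtype.ext (funext fun j => ?_)
    by_cases hj : j = i
    · subst hj
      rw [shuffle_apply_self _ hy]
      have := hB (updateCoord j x ⟨y.1 j, y.2 j⟩) y (fun k b hb => ?_) j
      · rw [updateCoord_self] at this
        exact sub_left_inj.1 this
      · by_cases hk : k = j
        · subst hk
          rw [updateCoord_self]
        · rw [updateCoord_of_ne hk]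
          exact hy.2 ⟨k, hk⟩ b hb
    · rw [shuffle_apply_of_ne _ _ _ hj, hf _ _ hj]
  have key : ∀ S : Set (Set ({j : Fin d // j ≠ i} → ℝ)), S.Finite → S ⊆ Set.range cell →
      ∃ g ∈ Subgroup.closure (restrictedShuffles d), ∀ y,
        (cell y ∈ S → g y = f y) ∧ (cell y ∉ S → g y = y) := by
    intro S hS
    induction S, hS using Set.Finite.induction_on with
    | empty => exact fun _ => ⟨1, one_mem _, fun y => ⟨fun h => h.elim, fun _ => rfl⟩⟩
    | @insert R S hRS _ ih =>
      intro hsub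
      obtain ⟨g, hg, hgf⟩ := ih ((Set.subset_insert _ _).trans hsub)
      obtain ⟨x, rfl⟩ := hsub (Set.mem_insert _ _)
      refine ⟨shuffle i (cell x) (linePerm i f hf x) * g,
        mul_mem (shuffle_mem_closure (isRectangle_gridCell B (hpr x)) (hline x)) hg,
        fun y => ?_⟩
      rw [Equiv.Perm.mul_apply]
      by_cases hyx : cell y = cell x
      · have h1 : prPerp i (y : Fin d → ℝ) ∈ cell x := hyx ▸ mem_gridCell_self (hpr y)
        rw [(hgf y).2 (hyx ▸ hRS), hfx x y h1]
        exact ⟨fun _ => rfl, fun h => absurd (hyx ▸ Set.mem_insert _ _) h⟩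
      · have h1 : prPerp i (y : Fin d → ℝ) ∉ cell x := fun h => hyx (gridCell_eq_of_mem h)
        constructor
        · intro h
          rw [(hgf y).1 (h.resolve_left hyx)]
          exact shuffle_apply_of_notMem _ (by rwa [hprf])
        · intro h
          rw [(hgf y).2 fun h' => h (Or.inr h')]
          exact shuffle_apply_of_notMem _ h1
  obtain ⟨g, hg, hgf⟩ := key _ hfin subset_rfl
  rwa [show f = g from Equiv.ext fun y => ((hgf y).1 ⟨y, rfl⟩).symm]

/-- The unit cube as a layered cube with a single layer. -/
def layeredEquiv (d : ℕ) : Layered d Unit ≃ unitCube (Fin d) where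
  toFun ω := ⟨fun i => ω.1 i, fun i => (ω.1 i).2⟩
  invFun x := (fun i => ⟨x.1 i, x.2 i⟩, ())
  left_inv _ := rfl
  right_inv _ := rfl

theorem isGridTranslation_permCongr_iff {d : ℕ} (f : Equiv.Perm (Layered d Unit)) :
    IsGridTranslation ((layeredEquiv d).permCongr f) ↔ IsExchange f := by
  constructor
  · rintro ⟨B, hB⟩
    exact ⟨B, fun ω ω' h => ⟨rfl, hB (layeredEquiv d ω) (layeredEquiv d ω') h.2⟩⟩
  · rintro ⟨B, hB⟩
    exact ⟨B, fun x y h => (hB ((layeredEquiv d).symm x) ((layeredEquiv d).symm y) ⟨rfl, h⟩).2⟩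

end RectangleExchange

theorem mainTheorem1 (d : ℕ) (hd : 1 ≤ d) :
    Subgroup.closure (RectangleExchange.restrictedShuffles d) = RectangleExchange.Rec d := by
  open RectangleExchange in
  apply le_antisymm
  · rw [Subgroup.closure_le]
    rintro _ ⟨i, R, s, hR, hs, rfl⟩
    exact (isGridTranslation_shuffle hR hs).isRectangleExchange
  · intro f hf
    set e := layeredEquiv d with he
    set F := e.permCongr.symm f with hF
    have hFf : e.permCongr F = f := e.permCongr.apply_symm_apply f
    have hFex : IsExchange F := by
      rw [← isGridTranslation_permCongr_iff, ← he, hFf]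
      exact IsRectangleExchange.isGridTranslation hf
    have h1 := IsExchange.mem_axisLayerSubgroup d (fun _ : Unit => ()) hFex fun _ => rfl
    have h2 : axisLayerSubgroup d (fun _ : Unit => ()) ≤
        (Subgroup.closure (restrictedShuffles d)).comap e.permCongrHom.toMonoidHom := by
      refine (Subgroup.closure_le _).2 ?_
      rintro G (hG | ⟨-, l, m, -, hG⟩)
      · obtain ⟨i, hi⟩ := Set.mem_iUnion.1 hG
        refine mem_closure_restrictedShuffles_of_axis (i := i)
          ((isGridTranslation_permCongr_iff G).2 hi.1) fun x j hj => ?_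
        exact congrArg Subtype.val ((hi.2 (e.symm x)).2 j hj)
      · have : G = 1 := Equiv.ext fun ω => Prod.ext (hG ω).1 rfl
        rw [this]
        exact one_mem _
    have h3 := h2 h1
    rwa [Subgroup.mem_comap, show e.permCongrHom.toMonoidHom F = f from hFf] at h3
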